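/- Let $K$ be a knot in $\mathbb R^3$ (given, as usual, by a knot diagram up to Reidemeister moves) and let $v_2(K)=\tfrac12\Delta_K''(1)$ be its Casson knot invariant, where $\Delta_K(t)\in\mathbb Z[t,t^{-1}]$ is the Alexander polynomial of $K$, normalized by $\Delta_K(t^{-1})=\Delta_K(t)$ and $\Delta_K(1)=1$. If $K$ admits a diagram with $n$ crossing points, then $$|v_2(K)|\le\left\lfloor \frac{n^2}{8}\right\rfloor .$$ -/

import Mathlib

open scoped LaurentPolynomial

/-- A passage of a knot diagram through one of its crossings: the name of the crossing, whether
the passage is on the upper branch, and the sign (local writhe) of the crossing. -/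
structure Passage where
  crossing : ℕ
  isOver : Bool
  sign : ℤˣ
deriving DecidableEq

namespace Passage

/-- The other passage through the same crossing. -/
def flip (x : Passage) : Passage := ⟨x.crossing, !x.isOver, x.sign⟩

end Passage

/-- A based Gauss diagram, written as its signed Gauss code: the list of all passages through
crossings, in the order in which they are met along the oriented circle from the base point.
Each crossing occurs exactly twice, once as an over- and once as an underpassage, with one sign.
The chord of a crossing joins its two positions in the list, and is directed from the
overpassage to the underpassage. -/
structure IsGaussCode (w : List Passage) : Prop where
  nodup : w.Nodup
  flip_mem : ∀ x ∈ w, x.flip ∈ w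
  sign_eq : ∀ x ∈ w, ∀ y ∈ w, x.crossing = y.crossing → x.sign = y.sign

namespace GaussCode

/-- The passage that follows `x` along the circle (cyclically); `(next w).symm x` precedes it. -/
def next (w : List Passage) : Equiv.Perm Passage := w.formPerm

/-! ### Planarity

A half-edge of the 4-valent graph of the diagram is a pair `(x, b)`: the part of the curve which
leaves the crossing after the passage `x` (`b = true`), or which arrives at the crossing for the
passage `x` (`b = false`). -/

/-- The other half of the same edge. -/
def otherEnd (w : List Passage) : Passage × Bool → Passage × Bool
  | (x, true) => (next w x, false)
  | (x, false) => ((next w).symm x, true)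

/-- The next half-edge counterclockwise around the same crossing. At a positive crossing the
counterclockwise order is over-out, under-out, over-in, under-in; at a negative crossing it is
over-out, under-in, over-in, under-out. -/
def rotate : Passage × Bool → Passage × Bool
  | (x, b) => (x.flip, if x.isOver = decide (x.sign = 1) then b else !b)

/-- One step along the boundary of a face. -/
def faceStep (w : List Passage) (d : Passage × Bool) : Passage × Bool := rotate (otherEnd w d)

/-- The number of faces: the number of orbits of half-edges under `faceStep`. -/
noncomputable def faceCount (w : List Passage) : ℕ :=
  Nat.card (Quot fun d e : {x // x ∈ w} × Bool => faceStep w (d.1.1, d.2) = (e.1.1, e.2))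

/-- A Gauss code is planar (it comes from a generic immersion of the circle in the plane) when
the closed surface obtained by gluing a disc to each face of the connected graph of the diagram
is a sphere: `V + F = E + 2`, with `V = w.length / 2` and `E = w.length`.
The empty code is the circle embedded without crossings. -/
def IsPlanar (w : List Passage) : Prop :=
  w = [] ∨ w.length / 2 + faceCount w = w.length + 2

/-! ### Reidemeister moves -/

/-- The two passages in the given order if `s = 1`, in the opposite order if `s = -1`. -/
def ordered (s : ℤˣ) (x y : Passage) : List Passage := if s = 1 then [x, y] else [y, x]

/-- The strands of a third Reidemeister move. The top strand `T`, the middle strand `M` and the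
bottom strand `B` meet in the crossings `a = TM`, `b = TB`, `c = MB` of signs `x`, `y`, `z`.
`q = ±1` tells on which side of the crossing `a` the strand `B` passes; together with the signs
it determines the order of the two crossings on each strand. -/
def strandT (a b : ℕ) (x y q : ℤˣ) : List Passage :=
  ordered (q * y) ⟨a, true, x⟩ ⟨b, true, y⟩

/-- The middle strand of a third Reidemeister move, see `strandT`. -/
def strandM (a c : ℕ) (x z q : ℤˣ) : List Passage :=
  ordered (q * z) ⟨a, false, x⟩ ⟨c, true, z⟩

/-- The bottom strand of a third Reidemeister move, see `strandT`. -/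
def strandB (b c : ℕ) (x y z q : ℤˣ) : List Passage :=
  ordered (q * x * y * z) ⟨b, false, y⟩ ⟨c, false, z⟩

/-- The moves of Gauss codes: change of base point, renaming of crossings, and the oriented
Reidemeister moves. They are used only between planar Gauss codes (see `KnotDiagram.Move`); there
the new crossings have new names, and the loop, bigon or triangle of the move is a face. -/
inductive Move : List Passage → List Passage → Prop
  | base (u v : List Passage) : Move (u ++ v) (v ++ u)
  | rename (f : Equiv.Perm ℕ) (w : List Passage) :
      Move w (w.map fun x => ⟨f x.crossing, x.isOver, x.sign⟩)
  /-- First move: a kink, of either sign, running over or under itself first. -/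
  | one (a : ℕ) (o : Bool) (s : ℤˣ) (u : List Passage) :
      Move u ([⟨a, o, s⟩, ⟨a, !o, s⟩] ++ u)
  /-- Second move, for two strands with the same direction. -/
  | twoParallel (a b : ℕ) (s : ℤˣ) (u v : List Passage) :
      Move (u ++ v)
        ([⟨a, true, s⟩, ⟨b, true, -s⟩] ++ u ++ [⟨a, false, s⟩, ⟨b, false, -s⟩] ++ v)
  /-- Second move, for two strands with opposite directions. -/
  | twoAntiparallel (a b : ℕ) (s : ℤˣ) (u v : List Passage) :
      Move (u ++ v)
        ([⟨a, true, s⟩, ⟨b, true, -s⟩] ++ u ++ [⟨b, false, -s⟩, ⟨a, false, s⟩] ++ v)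
  /-- Third move, for strands that follow each other in the cyclic order `T`, `M`, `B`. -/
  | threeTMB (a b c : ℕ) (x y z q : ℤˣ) (u v w : List Passage) :
      Move (strandT a b x y q ++ u ++ strandM a c x z q ++ v ++ strandB b c x y z q ++ w)
        (strandT a b x y (-q) ++ u ++ strandM a c x z (-q) ++ v ++ strandB b c x y z (-q) ++ w)
  /-- Third move, for strands that follow each other in the cyclic order `T`, `B`, `M`. -/
  | threeTBM (a b c : ℕ) (x y z q : ℤˣ) (u v w : List Passage) :
      Move (strandT a b x y q ++ u ++ strandB b c x y z q ++ v ++ strandM a c x z q ++ w)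
        (strandT a b x y (-q) ++ u ++ strandB b c x y z (-q) ++ v ++ strandM a c x z (-q) ++ w)

/-! ### The Alexander matrix -/

/-- The Alexander matrix (the abelianized Fox Jacobian) of the Wirtinger presentation of the knot
group, with one generator for each edge of the diagram and one relation for each passage. Columns
are indexed by edges, an edge being named by the passage that it follows. At an overpassage the
outgoing and the incoming edge are equal; at an underpassage of sign `s` one has
`out = t ^ s * in + (1 - t ^ s) * over`. -/
noncomputable def alexanderMatrix (w : List Passage) : Matrix Passage Passage ℤ[T;T⁻¹] := fun x =>
  if x.isOver then
    Pi.single x 1 - Pi.single ((next w).symm x) 1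
  else
    Pi.single x 1 - Pi.single ((next w).symm x) (LaurentPolynomial.T (x.sign : ℤ))
      - Pi.single x.flip (1 - LaurentPolynomial.T (x.sign : ℤ))

/-- The minor of the Alexander matrix obtained by deleting the row and the column of the first
passage. -/
noncomputable def alexanderMinor (w : List Passage) : ℤ[T;T⁻¹] :=
  ((alexanderMatrix w).submatrix (fun x : {x // x ∈ w.tail} => x.1) (fun y => y.1)).det

end GaussCode

/-- An oriented knot diagram (with a base point and names for its crossings): a planar Gauss
code. -/
structure KnotDiagram where
  code : List Passage
  isGaussCode : IsGaussCode code
  isPlanar : GaussCode.IsPlanar code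

namespace KnotDiagram

/-- The number of crossings. -/
def crossingCount (D : KnotDiagram) : ℕ := D.code.length / 2

/-- `D` and `E` differ by one Reidemeister move, the position of the base point, or the names of
the crossings. -/
def Move (D E : KnotDiagram) : Prop := GaussCode.Move D.code E.code

end KnotDiagram

/-- Oriented knots, as knot diagrams up to the equivalence relation generated by the Reidemeister
moves. -/
def Knot : Type := Quot KnotDiagram.Move

namespace Knot

/-- `D` is a diagram of the knot `K`. -/
def HasDiagram (K : Knot) (D : KnotDiagram) : Prop := Quot.mk KnotDiagram.Move D = K

/-- The value of a Laurent polynomial at `t = 1`. -/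
noncomputable def evalOne : ℤ[T;T⁻¹] →+* ℤ := LaurentPolynomial.eval₂ (RingHom.id ℤ) 1

/-- The formal derivative `d/dt` of a Laurent polynomial. -/
noncomputable def deriv (f : ℤ[T;T⁻¹]) : ℤ[T;T⁻¹] :=
  f.coeff.sum fun k a => LaurentPolynomial.C (a * k) * LaurentPolynomial.T (k - 1)

/-- `Δ` is the normalized Alexander polynomial of `K`: up to a unit `± t ^ k` it is the Alexander
determinant of a diagram of `K`, and it satisfies `Δ(t⁻¹) = Δ(t)` and `Δ(1) = 1`. -/
def IsAlexanderPolynomial (K : Knot) (Δ : ℤ[T;T⁻¹]) : Prop :=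
  (∃ D : KnotDiagram, K.HasDiagram D ∧ Associated Δ (GaussCode.alexanderMinor D.code)) ∧
    LaurentPolynomial.invert Δ = Δ ∧ evalOne Δ = 1

open Classical in
/-- The Alexander polynomial of `K`, normalized by `Δ(t⁻¹) = Δ(t)` and `Δ(1) = 1`.
(It always exists and is unique; the value `1` in the other case is never used.) -/
noncomputable def alexanderPolynomial (K : Knot) : ℤ[T;T⁻¹] :=
  if h : ∃ Δ, K.IsAlexanderPolynomial Δ then h.choose else 1

/-- The Casson knot invariant `v₂(K) = Δ_K''(1) / 2`. -/
noncomputable def v₂ (K : Knot) : ℚ := (evalOne (deriv (deriv K.alexanderPolynomial)) : ℚ) / 2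

end Knot

/-! The proof identifies `v₂` with the Polyak–Viro arrow diagram sum `GaussCode.casson` and bounds
that sum by counting pairs of chords.

Identification. At `t = 1` the reduced Alexander matrix is the difference operator along the based
curve, and its inverse is the matrix of the linear order of the passages. Multiplying by this
inverse turns the matrix into `1 - N`, where `N` is divisible by `t - 1`
(`alexander_mul_orderMatrix`). With `t = exp X`, the `X ^ 2` coefficient of the logarithm of the
determinant does not see units `t ^ k`. For a symmetric normalized polynomial it is half the second
derivative at `1`, and for `1 - N` traces of `N` turn it into a signed count of pairs of arrows in
the order over, under, under, over (`coeff_expHom_alexander`).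

Invariance. The polynomial may come from any diagram of the knot, so the arrow sum must be carried
to the diagram with few crossings (`casson_move`). The Reidemeister moves are checked on the code
alone. Moving the base point needs planarity, through one fact: the two loops at a crossing have
algebraic intersection number zero (`sum_linked_eq_zero`). Here the sphere enters as a discrete
Hodge decomposition: by Euler's formula every cycle of edges bounds a combination of faces
(`exists_edgeDiff_eq`), which supplies a winding number function.

Bound. From the base point, `k` crossings are met over first and `n - k` under first. The formula
counts linked pairs with one crossing of each kind, interleaved in one of the two possible ways. The
intersection fact also shows that the sum over the other way of interleaving has the same value
(`sum_linked_eq_sum_linked_flip`). A pair interleaves in at most one way, so `2 |v₂| ≤ k (n - k) ≤ n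
^ 2 / 4`. -/

namespace LaurentPolynomial

/-! ### Laurent polynomials at `t = exp X` and the effect of units -/

/-- The substitution `T = exp X`. -/
noncomputable def expHom : ℤ[T;T⁻¹] →+* PowerSeries ℚ :=
  (AddMonoidAlgebra.lift ℤ (PowerSeries ℚ) ℤ
    { toFun := fun k => PowerSeries.rescale ((k.toAdd : ℤ) : ℚ) (PowerSeries.exp ℚ)
      map_one' := by simp
      map_mul' := fun a b => by
        rw [PowerSeries.exp_mul_exp_eq_exp_add]; simp } : ℤ[T;T⁻¹] →ₐ[ℤ] PowerSeries ℚ).toRingHom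

theorem expHom_T (k : ℤ) :
    expHom (T k) = PowerSeries.rescale (k : ℚ) (PowerSeries.exp ℚ) := by
  simp [expHom, T, -single_eq_C_mul_T]
  exact one_zsmul _

theorem coeff_expHom_C_mul_T (a k : ℤ) (n : ℕ) :
    PowerSeries.coeff n (expHom (C a * T k)) = a * k ^ n / n.factorial := by
  have : (C a : ℤ[T;T⁻¹]) = ((a : ℤ) : ℤ[T;T⁻¹]) := by simp
  rw [this, map_mul, expHom_T, map_intCast, ← map_intCast (PowerSeries.C (R := ℚ)),
    PowerSeries.coeff_C_mul]
  simp [PowerSeries.coeff_exp]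
  ring

/-- After clearing denominators, `u` becomes a divisor of a power of the prime `X` in `ℤ[X]`. -/
theorem exists_eq_C_mul_T_of_isUnit {u : ℤ[T;T⁻¹]} (hu : IsUnit u) :
    ∃ e k : ℤ, u = C e * T k := by
  obtain ⟨v, hv⟩ := hu.exists_right_inv
  obtain ⟨n, p, hp⟩ := exists_T_pow u
  obtain ⟨m, q, hq⟩ := exists_T_pow v
  have h : p * q = Polynomial.X ^ (n + m) := by
    apply Polynomial.toLaurent_injective
    rw [map_mul, hp, hq, Polynomial.toLaurent_X_pow, Nat.cast_add, T_add]
    linear_combination (T n * T m) * hv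
  obtain ⟨i, -, hi⟩ := (dvd_prime_pow Polynomial.prime_X (n + m)).1 (Dvd.intro q h)
  obtain ⟨c, hc⟩ := hi.symm
  obtain ⟨e, -, he⟩ := Polynomial.isUnit_iff.1 c.isUnit
  refine ⟨e, i - n, ?_⟩
  have : u * T n = C e * T i := by
    rw [← hp, ← hc, ← he, map_mul]; simp [mul_comm]
  rw [T_sub, ← mul_assoc, ← this, mul_assoc, ← T_add]; simp

end LaurentPolynomial

namespace Knot
open LaurentPolynomial

theorem coeff_zero_expHom (f : ℤ[T;T⁻¹]) :
    PowerSeries.coeff 0 (expHom f) = evalOne f := by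
  induction f using LaurentPolynomial.induction_on' with
  | add p q hp hq => simp [map_add, hp, hq]
  | C_mul_T n a => rw [coeff_expHom_C_mul_T]; simp [evalOne]

theorem deriv_add (f g : ℤ[T;T⁻¹]) : deriv (f + g) = deriv f + deriv g := by
  unfold deriv
  rw [AddMonoidAlgebra.coeff_add, Finsupp.sum_add_index']
  · simp
  · intros; rw [add_mul, map_add, add_mul]

theorem deriv_C_mul_T (a n : ℤ) : deriv (C a * T n) = C (a * n) * T (n - 1) := by
  rw [← single_eq_C_mul_T]
  simp [deriv, -single_eq_C_mul_T]

theorem evalOne_deriv_deriv (f : ℤ[T;T⁻¹]) :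
    (evalOne (deriv (deriv f)) : ℚ) =
      2 * PowerSeries.coeff 2 (expHom f) - PowerSeries.coeff 1 (expHom f) := by
  induction f using LaurentPolynomial.induction_on' with
  | add p q hp hq => simp only [deriv_add, map_add, Int.cast_add, hp, hq]; ring
  | C_mul_T n a =>
    rw [coeff_expHom_C_mul_T, coeff_expHom_C_mul_T, deriv_C_mul_T, deriv_C_mul_T]
    simp [evalOne]
    ring

theorem coeff_one_expHom_invert (f : ℤ[T;T⁻¹]) :
    PowerSeries.coeff 1 (expHom (invert f)) = - PowerSeries.coeff 1 (expHom f) := by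
  induction f using LaurentPolynomial.induction_on' with
  | add p q hp hq => simp only [map_add, hp, hq]; ring
  | C_mul_T n a =>
    rw [map_mul, invert_C, invert_T, coeff_expHom_C_mul_T, coeff_expHom_C_mul_T]
    simp

theorem _root_.PowerSeries.coeff_two_mul {R : Type*} [CommRing R] (f g : PowerSeries R) :
    PowerSeries.coeff 2 (f * g) = PowerSeries.coeff 0 f * PowerSeries.coeff 2 g +
      PowerSeries.coeff 1 f * PowerSeries.coeff 1 g +
      PowerSeries.coeff 2 f * PowerSeries.coeff 0 g := by
  rw [PowerSeries.coeff_mul]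
  simp [Finset.Nat.antidiagonal_succ]; ring

theorem _root_.PowerSeries.coeff_one_mul' {R : Type*} [CommRing R] (f g : PowerSeries R) :
    PowerSeries.coeff 1 (f * g) = PowerSeries.coeff 0 f * PowerSeries.coeff 1 g +
      PowerSeries.coeff 1 f * PowerSeries.coeff 0 g := by
  rw [PowerSeries.coeff_mul]
  simp [Finset.Nat.antidiagonal_succ]

/-- For a series with constant term `1`, the right-hand side is the `X ^ 2` coefficient of its
logarithm. A unit `t ^ k` only adds `k X` to the logarithm. Symmetry kills the linear coefficient of
`Δ`, so for `Δ` itself this coefficient is `Δ''(1) / 2`. -/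
theorem evalOne_deriv_deriv_of_associated {Δ f : ℤ[T;T⁻¹]} (h : Associated Δ f)
    (hs : invert Δ = Δ) (h1 : evalOne Δ = 1) (hf : evalOne f = 1) :
    (evalOne (deriv (deriv Δ)) : ℚ) / 2 =
      PowerSeries.coeff 2 (expHom f) - PowerSeries.coeff 1 (expHom f) ^ 2 / 2 := by
  obtain ⟨u, rfl⟩ := h
  obtain ⟨e, k, hu⟩ := exists_eq_C_mul_T_of_isUnit u.isUnit
  have he : e = 1 := by
    rw [map_mul, h1, one_mul, hu] at hf
    simpa [evalOne, eval₂_C_mul_T] using hf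
  have hc := coeff_one_expHom_invert Δ
  rw [hs] at hc
  have hc1 : PowerSeries.coeff 1 (expHom Δ) = 0 := by linarith
  have h0 := coeff_zero_expHom Δ
  rw [h1] at h0
  rw [evalOne_deriv_deriv, hu, map_mul, PowerSeries.coeff_two_mul, PowerSeries.coeff_one_mul',
    coeff_expHom_C_mul_T, coeff_expHom_C_mul_T, coeff_expHom_C_mul_T, hc1, h0, he]
  simp

end Knot

/-! ### Second-order expansion of `det (1 - X M)` -/

namespace Matrix
open Polynomial

theorem det_submatrix_pair {n R : Type*} [DecidableEq n] [CommRing R] (M : Matrix n n R)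
    {a b : n} (hab : a ≠ b) :
    (M.submatrix (Subtype.val : ({a, b} : Finset n) → n) Subtype.val).det =
      M a a * M b b - M a b * M b a := by
  let e : Fin 2 → ({a, b} : Finset n) := ![⟨a, by simp⟩, ⟨b, by simp⟩]
  have he : Function.Bijective e := by
    constructor
    · intro i j
      fin_cases i <;> fin_cases j <;> simp [e, hab, hab.symm]
    · rintro ⟨x, hx⟩
      rw [Finset.mem_insert, Finset.mem_singleton] at hx
      rcases hx with rfl | rfl
      · exact ⟨0, rfl⟩
      · exact ⟨1, rfl⟩
  rw [← det_submatrix_equiv_self (Equiv.ofBijective e he), det_fin_two]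
  rfl

theorem coeff_two_det_one_add_X_smul {n R : Type*} [Fintype n] [DecidableEq n] [CommRing R]
    (M : Matrix n n R) :
    2 * (det (1 + (X : R[X]) • M.map C)).coeff 2 = M.trace ^ 2 - (M * M).trace := by
  have hsum : M.trace ^ 2 - (M * M).trace =
      ∑ p ∈ (Finset.univ : Finset n).offDiag, (M p.1 p.1 * M p.2 p.2 - M p.1 p.2 * M p.2 p.1) := by
    rw [Finset.sum_subset (Finset.subset_univ _), Fintype.sum_prod_type, sq, trace, trace,
      Finset.sum_mul_sum, ← Finset.sum_sub_distrib]
    · refine Finset.sum_congr rfl fun i _ => ?_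
      rw [show (M * M).diag i = ∑ j, M i j * M j i from mul_apply, ← Finset.sum_sub_distrib]
      rfl
    · rintro ⟨i, j⟩ - h
      have : i = j := by simpa using h
      subst this
      ring
  rw [coeff_det_one_add_X_smul_eq_sum_minors, hsum, Finset.mul_sum]
  -- Each two-element set carries one principal minor and is hit by two ordered pairs, which
  -- accounts for the factor `2`.
  rw [← Finset.sum_fiberwise_of_maps_to (g := fun p : n × n => ({p.1, p.2} : Finset n))
    (t := Finset.univ.powersetCard 2)]
  · refine Finset.sum_congr rfl fun s hs => ?_
    obtain ⟨a, b, hab, rfl⟩ := Finset.card_eq_two.1 (Finset.mem_powersetCard.1 hs).2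
    have : ((Finset.univ : Finset n).offDiag.filter fun p => ({p.1, p.2} : Finset n) = {a, b}) =
        {(a, b), (b, a)} := by
      ext ⟨i, j⟩
      simp only [Finset.mem_filter, Finset.mem_offDiag, Finset.mem_univ, true_and,
        Finset.mem_insert, Finset.mem_singleton, Prod.mk.injEq]
      constructor
      · rintro ⟨hij, h⟩
        have hi : i ∈ ({a, b} : Finset n) := h ▸ by simp
        have hj : j ∈ ({a, b} : Finset n) := h ▸ by simp
        simp only [Finset.mem_insert, Finset.mem_singleton] at hi hj
        rcases hi with rfl | rfl <;> rcases hj with rfl | rfl <;> simp_all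
      · rintro (⟨rfl, rfl⟩ | ⟨rfl, rfl⟩)
        · exact ⟨hab, rfl⟩
        · exact ⟨hab.symm, Finset.pair_comm _ _⟩
    rw [this, Finset.sum_pair (by simp [hab]), det_submatrix_pair M hab]
    ring
  · rintro ⟨i, j⟩ h
    have : i ≠ j := by simpa using h
    simp [Finset.mem_powersetCard, Finset.card_pair this]

/-- This is `log det (1 - X M) = - X tr M - X ^ 2 tr (M ^ 2) / 2 - ...` to second order. The entries
of `M` are themselves series in `X`, so the determinant is first expanded in an independent
variable, which is then evaluated at `X`. -/
theorem coeff_det_one_sub_X_smul {n : Type*} [Fintype n] [DecidableEq n]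
    (M : Matrix n n (PowerSeries ℚ)) :
    PowerSeries.coeff 0 (det (1 - (PowerSeries.X : PowerSeries ℚ) • M)) = 1 ∧
      PowerSeries.coeff 2 (det (1 - (PowerSeries.X : PowerSeries ℚ) • M)) -
        PowerSeries.coeff 1 (det (1 - (PowerSeries.X : PowerSeries ℚ) • M)) ^ 2 / 2 =
        - PowerSeries.coeff 1 M.trace - PowerSeries.coeff 0 (M * M).trace / 2 := by
  set P : (PowerSeries ℚ)[X] := det (1 + (X : (PowerSeries ℚ)[X]) • (-M).map C) with hP
  have hD : det (1 - (PowerSeries.X : PowerSeries ℚ) • M) = P.eval PowerSeries.X := by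
    rw [hP, ← coe_evalRingHom, RingHom.map_det]
    congr 1
    ext i j
    by_cases h : i = j <;> simp [h, sub_eq_add_neg]
  have h0 : P.coeff 0 = 1 := by
    rw [coeff_zero_eq_eval_zero, hP, ← coe_evalRingHom, RingHom.map_det]
    rw [← det_one (n := n)]
    congr 1
    ext i j : 1
    rcases eq_or_ne i j with rfl | h <;> simp [*]
  have h1 : P.coeff 1 = - M.trace := by
    rw [hP, coeff_det_one_add_X_smul_one, trace_neg]
  have h2 : 2 * P.coeff 2 = M.trace ^ 2 - (M * M).trace := by
    rw [hP, coeff_two_det_one_add_X_smul]; simp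
  have hexp : P.eval PowerSeries.X = P.coeff 0 + PowerSeries.X * (P.coeff 1 + PowerSeries.X *
      (P.coeff 2 + PowerSeries.X * P.divX.divX.divX.eval PowerSeries.X)) := by
    conv_lhs => rw [← divX_mul_X_add P, ← divX_mul_X_add P.divX, ← divX_mul_X_add P.divX.divX]
    simp only [eval_add, eval_mul, eval_X, eval_C, coeff_divX]
    ring
  rw [hD, hexp, h0, h1]
  have h2' : 2 * PowerSeries.coeff 0 (P.coeff 2) =
      PowerSeries.coeff 0 M.trace ^ 2 - PowerSeries.coeff 0 (M * M).trace := by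
    have := congrArg (PowerSeries.coeff 0) h2
    rw [two_mul] at this ⊢
    simpa using this
  have c1 : ∀ f : PowerSeries ℚ, PowerSeries.coeff 1 (PowerSeries.X * f) = PowerSeries.coeff 0 f :=
    fun f => PowerSeries.coeff_succ_X_mul 0 f
  have c2 : ∀ f : PowerSeries ℚ, PowerSeries.coeff 2 (PowerSeries.X * f) = PowerSeries.coeff 1 f :=
    fun f => PowerSeries.coeff_succ_X_mul 1 f
  refine ⟨by simp, ?_⟩
  simp only [map_add, c1, c2, map_neg, PowerSeries.coeff_zero_X_mul, add_zero,
    PowerSeries.coeff_one]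
  norm_num
  simp only [PowerSeries.coeff_zero_eq_constantCoeff] at h2'
  linarith

end Matrix

/-! ### The order of the passages -/

namespace Passage

@[simp] theorem flip_flip (x : Passage) : x.flip.flip = x := by simp [flip]

@[simp] theorem isOver_flip (x : Passage) : x.flip.isOver = !x.isOver := rfl

@[simp] theorem sign_flip (x : Passage) : x.flip.sign = x.sign := rfl

@[simp] theorem crossing_flip (x : Passage) : x.flip.crossing = x.crossing := rfl

theorem flip_injective : Function.Injective flip := fun x y h => by
  rw [← flip_flip x, h, flip_flip]

theorem flip_ne (x : Passage) : x.flip ≠ x := fun h => by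
  have := congrArg isOver h
  simp at this

end Passage

namespace GaussCode

/-- The passage `x` comes before the passage `y`. -/
def before (w : List Passage) (x y : Passage) : Prop := [x, y].Sublist w

instance (w : List Passage) (x y : Passage) : Decidable (before w x y) :=
  inferInstanceAs (Decidable ([x, y].Sublist w))

@[simp] theorem not_before_nil (x y : Passage) : ¬ before [] x y := by simp [before]

theorem before_cons {a : Passage} {l : List Passage} {x y : Passage} :
    before (a :: l) x y ↔ (x = a ∧ y ∈ l) ∨ before l x y := by
  unfold before
  rw [List.sublist_cons_iff]
  constructor
  · rintro (h | ⟨r, hr, h⟩)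
    · exact Or.inr h
    · obtain ⟨rfl, rfl⟩ := List.cons.inj hr
      exact Or.inl ⟨rfl, by simpa using h⟩
  · rintro (⟨rfl, h⟩ | h)
    · exact Or.inr ⟨[y], rfl, by simpa using h⟩
    · exact Or.inl h

theorem before_append {u v : List Passage} {x y : Passage} :
    before (u ++ v) x y ↔ before u x y ∨ before v x y ∨ (x ∈ u ∧ y ∈ v) := by
  induction u with
  | nil => simp
  | cons a u ih =>
    rw [List.cons_append, before_cons, before_cons, ih, List.mem_append, List.mem_cons]
    tauto

theorem before.left_mem {w : List Passage} {x y : Passage} (h : before w x y) : x ∈ w :=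
  h.subset (by simp)

theorem before.right_mem {w : List Passage} {x y : Passage} (h : before w x y) : y ∈ w :=
  h.subset (by simp)

theorem before_iff_idxOf {w : List Passage} (hw : w.Nodup) {x y : Passage} :
    before w x y ↔ x ∈ w ∧ y ∈ w ∧ w.idxOf x < w.idxOf y := by
  induction w with
  | nil => simp
  | cons a l ih =>
    rw [List.nodup_cons] at hw
    rw [before_cons, ih hw.2]
    by_cases hx : x = a
    · subst hx
      by_cases hy : y = x
      · subst hy; simp [hw.1]
      · simp [hw.1, hy, List.idxOf_cons_ne _ (Ne.symm hy)]
    · by_cases hy : y = a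
      · subst hy; simp [hw.1, hx]
      · simp [hx, hy, List.idxOf_cons_ne _ (Ne.symm hy), List.idxOf_cons_ne _ (Ne.symm hx)]

theorem before.ne {w : List Passage} (hw : w.Nodup) {x y : Passage} (h : before w x y) :
    x ≠ y := by
  rintro rfl
  rw [before_iff_idxOf hw] at h
  omega

theorem not_before_self {w : List Passage} (hw : w.Nodup) (x : Passage) : ¬ before w x x :=
  fun h => h.ne hw rfl

theorem before.not_before {w : List Passage} (hw : w.Nodup) {x y : Passage} (h : before w x y) :
    ¬ before w y x := by
  rw [before_iff_idxOf hw] at *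
  omega

theorem before.trans {w : List Passage} (hw : w.Nodup) {x y z : Passage} (h : before w x y)
    (h' : before w y z) : before w x z := by
  rw [before_iff_idxOf hw] at *
  exact ⟨h.1, h'.2.1, h.2.2.trans h'.2.2⟩

theorem before_or_before {w : List Passage} (hw : w.Nodup) {x y : Passage} (hx : x ∈ w)
    (hy : y ∈ w) (h : x ≠ y) : before w x y ∨ before w y x := by
  rw [before_iff_idxOf hw, before_iff_idxOf hw]
  have : w.idxOf x ≠ w.idxOf y := fun e => h ((List.idxOf_inj hx).1 e)
  grind

theorem not_before_iff {w : List Passage} (hw : w.Nodup) {x y : Passage} (hx : x ∈ w)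
    (hy : y ∈ w) (h : x ≠ y) : ¬ before w x y ↔ before w y x :=
  ⟨(before_or_before hw hx hy h).resolve_left, fun h' => h'.not_before hw⟩

theorem next_append_cons_cons {a b : List Passage} {z x : Passage}
    (hw : (a ++ z :: x :: b).Nodup) : next (a ++ z :: x :: b) z = x := by
  have := List.formPerm_apply_lt_getElem _ hw a.length (by simp)
  simpa [next] using this

theorem exists_eq_append_of_mem_tail {p : Passage} {l : List Passage} {x : Passage}
    (hx : x ∈ l) : ∃ a z b, p :: l = a ++ z :: x :: b := by
  obtain ⟨s, t, rfl⟩ := List.append_of_mem hx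
  rcases List.eq_nil_or_concat s with rfl | ⟨s, z, rfl⟩
  · exact ⟨[], p, t, rfl⟩
  · exact ⟨p :: s, z, t, by simp⟩

/-- Away from the base point the cyclic predecessor is the predecessor in the list; this makes the
order matrix telescope against the Alexander matrix. -/
theorem before_next_symm {p : Passage} {l : List Passage} (hw : (p :: l).Nodup) {x : Passage}
    (hx : x ∈ l) (y : Passage) :
    before (p :: l) y x ↔ y = (next (p :: l)).symm x ∨ before (p :: l) y ((next (p :: l)).symm x) := by
  obtain ⟨a, z, b, h⟩ := exists_eq_append_of_mem_tail (p := p) hx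
  rw [h] at hw ⊢
  have hz : (next (a ++ z :: x :: b)).symm x = z := by
    rw [Equiv.symm_apply_eq, next_append_cons_cons hw]
  rw [hz]
  simp only [before_append, before_cons, List.mem_cons]
  simp only [List.nodup_append, List.nodup_cons, List.mem_cons] at hw
  have h1 : ∀ {l y}, x ∉ l → ¬ before l y x := fun h h' => h h'.right_mem
  have h2 : ∀ {l y}, z ∉ l → ¬ before l y z := fun h h' => h h'.right_mem
  have hxa : x ∉ a := fun h => hw.2.2 x h x (by simp) rfl
  have hza : z ∉ a := fun h => hw.2.2 z h z (by simp) rfl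
  have hxb : x ∉ b := by tauto
  have hzb : z ∉ b := by tauto
  have hzx : z ≠ x := by tauto
  have := h1 (y := y) hxa
  have := h2 (y := y) hza
  have := h1 (y := y) hxb
  have := h2 (y := y) hzb
  tauto

theorem next_symm_mem {w : List Passage} {x : Passage} (hx : x ∈ w) : (next w).symm x ∈ w := by
  rw [← List.formPerm_mem_iff_mem]
  change next w _ ∈ w
  rwa [Equiv.apply_symm_apply]

/-! ### The Casson invariant of a Gauss code -/

/-- The passages `x` and `y` are underpassages, and together with their overpassages they occur
in the order `y.flip`, `x`, `y`, `x.flip`. -/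
def OUUO (w : List Passage) (x y : Passage) : Prop :=
  x.isOver = false ∧ y.isOver = false ∧ before w y.flip x ∧ before w x y ∧ before w y x.flip

instance (w : List Passage) (x y : Passage) : Decidable (OUUO w x y) :=
  inferInstanceAs (Decidable (_ ∧ _))

/-- The value of the arrow diagram formula of Polyak and Viro. -/
def casson (w : List Passage) : ℤ :=
  ∑ x ∈ w.toFinset, ∑ y ∈ w.toFinset, if OUUO w x y then (x.sign : ℤ) * y.sign else 0

end GaussCode

/-! ### From the Alexander determinant to the arrow formula -/

namespace LaurentPolynomial

/-- The power series `(exp (k X) - 1) / X`. -/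
noncomputable def expSubOneDivX (k : ℤ) : PowerSeries ℚ :=
  PowerSeries.mk fun n => PowerSeries.coeff (n + 1) (PowerSeries.rescale (k : ℚ) (PowerSeries.exp ℚ))

theorem X_mul_expSubOneDivX (k : ℤ) :
    PowerSeries.X * expSubOneDivX k = expHom (T k - 1) := by
  rw [map_sub, map_one, expHom_T]
  ext n
  cases n with
  | zero =>
    rw [map_sub, PowerSeries.coeff_rescale, PowerSeries.coeff_exp, PowerSeries.coeff_zero_X_mul]
    simp
  | succ n => simp [PowerSeries.coeff_succ_X_mul, expSubOneDivX, PowerSeries.coeff_one]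

theorem coeff_zero_expSubOneDivX (k : ℤ) : PowerSeries.coeff 0 (expSubOneDivX k) = k := by
  simp [expSubOneDivX, PowerSeries.coeff_exp]

theorem coeff_one_expSubOneDivX (k : ℤ) : PowerSeries.coeff 1 (expSubOneDivX k) = k ^ 2 / 2 := by
  simp [expSubOneDivX, PowerSeries.coeff_exp]
  ring

end LaurentPolynomial

namespace GaussCode
open LaurentPolynomial

/-- The matrix of the (non-strict) order of the passages after the base point. -/
def orderMatrix (R : Type*) [Zero R] [One R] (w : List Passage) :
    Matrix {x // x ∈ w.tail} {x // x ∈ w.tail} R :=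
  fun x y => if y.1 = x.1 ∨ before w y x then 1 else 0

/-- For an underpassage `x`, how `x` and `x.flip` lie with respect to `y`. -/
def underCoeff (R : Type*) [Ring R] (w : List Passage) (x y : Passage) : R :=
  (if before w y x then 1 else 0) - if y = x.flip ∨ before w y x.flip then 1 else 0

/-- The deleted column is harmless: no remaining passage precedes `p`, so both sides vanish for `u =
p`. -/
theorem sum_single_mul_orderMatrix {R : Type*} [CommRing R] {p : Passage} {l : List Passage}
    (hw : (p :: l).Nodup) {u : Passage} (hu : u ∈ p :: l) (c : R)
    (y : {x // x ∈ (p :: l).tail}) :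
    ∑ z : {x // x ∈ (p :: l).tail}, (Pi.single u c : Passage → R) z.1 *
      orderMatrix R (p :: l) z y = if y.1 = u ∨ before (p :: l) y u then c else 0 := by
  obtain ⟨y, hy⟩ := y
  by_cases hu' : u ∈ l
  · rw [Finset.sum_eq_single (⟨u, hu'⟩ : {x // x ∈ (p :: l).tail})]
    · simp [orderMatrix]
    · rintro ⟨z, hz⟩ - h
      have : z ≠ u := fun e => h (Subtype.ext e)
      simp [this]
    · exact fun h => absurd (Finset.mem_univ _) h
  · have hup : u = p := by simpa [hu'] using hu
    subst hup
    have h1 : y ≠ u := fun e => hu' (e ▸ hy)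
    have h2 : ¬ before (u :: l) y u := by
      intro h
      rw [before_cons] at h
      rcases h with h | h
      · exact hu' h.2
      · exact hu' h.right_mem
    rw [if_neg (by tauto)]
    refine Finset.sum_eq_zero ?_
    rintro ⟨z, hz⟩ -
    have : z ≠ u := fun e => hu' (e ▸ hz)
    simp [this]

/-- An underpassage row is `(e_x - e_prev) - (t ^ s - 1) (e_prev - e_flip)`. The order matrix sums
differences back to the identity, and at or before the predecessor of `x` means strictly before `x`.
-/
theorem alexander_mul_orderMatrix {w : List Passage} (hw : IsGaussCode w) :
    (alexanderMatrix w).submatrix (fun x : {x // x ∈ w.tail} => x.1) (fun y => y.1) *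
        orderMatrix ℤ[T;T⁻¹] w =
      1 - Matrix.of fun x y : {x // x ∈ w.tail} =>
        if x.1.isOver then 0 else (T (x.1.sign : ℤ) - 1) * underCoeff ℤ[T;T⁻¹] w x y := by
  cases w with
  | nil => ext ⟨x, hx⟩; simp at hx
  | cons p l =>
  ext1 ⟨x, hx⟩ ⟨y, hy⟩
  have hx' : x ∈ p :: l := List.mem_cons_of_mem _ hx
  have hb := before_next_symm hw.nodup hx y
  have h1 : (1 : Matrix {x // x ∈ (p :: l).tail} {x // x ∈ (p :: l).tail} ℤ[T;T⁻¹])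
      ⟨x, hx⟩ ⟨y, hy⟩ = if y = x then 1 else 0 := by
    rw [Matrix.one_apply]
    simp only [Subtype.mk.injEq, eq_comm]
  rw [Matrix.mul_apply, Matrix.sub_apply, Matrix.of_apply, h1]
  simp only [Matrix.submatrix_apply, alexanderMatrix]
  by_cases ho : x.isOver
  · simp only [ho, if_true, Pi.sub_apply, sub_mul, Finset.sum_sub_distrib]
    rw [sum_single_mul_orderMatrix hw.nodup hx',
      sum_single_mul_orderMatrix hw.nodup (next_symm_mem hx')]
    simp only [← hb]
    rcases eq_or_ne y x with rfl | h
    · simp [not_before_self hw.nodup]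
    · simp [h]
  · simp only [ho, Pi.sub_apply, sub_mul, Finset.sum_sub_distrib, Bool.false_eq_true, if_false]
    rw [sum_single_mul_orderMatrix hw.nodup hx',
      sum_single_mul_orderMatrix hw.nodup (next_symm_mem hx'),
      sum_single_mul_orderMatrix hw.nodup (hw.flip_mem _ hx')]
    simp only [← hb]
    unfold underCoeff
    by_cases h' : y = x.flip ∨ before (p :: l) y x.flip <;> rcases eq_or_ne y x with rfl | h
    · simp only [not_before_self hw.nodup, h', if_true, if_false, or_false]; ring
    · by_cases h'' : before (p :: l) y x <;>
      · simp only [h, h', h'', if_true, if_false, false_or]; ring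
    · simp only [not_before_self hw.nodup, h', if_true, if_false, or_false]; ring
    · by_cases h'' : before (p :: l) y x <;>
      · simp only [h, h', h'', if_true, if_false, false_or]; ring

/-- At `t = 1` the factorization exhibits an integral left inverse of the order matrix, whose
entries are constants. -/
theorem isUnit_det_orderMatrix {w : List Passage} (hw : IsGaussCode w) :
    IsUnit (orderMatrix ℤ[T;T⁻¹] w).det := by
  have h := congrArg (RingHom.mapMatrix Knot.evalOne) (alexander_mul_orderMatrix hw)
  have h1 : (RingHom.mapMatrix Knot.evalOne) (orderMatrix ℤ[T;T⁻¹] w) = orderMatrix ℤ w := by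
    ext x y
    simp only [RingHom.mapMatrix_apply, Matrix.map_apply, orderMatrix]
    split_ifs <;> simp
  have h2 : orderMatrix ℤ[T;T⁻¹] w = (RingHom.mapMatrix C) (orderMatrix ℤ w) := by
    ext1 x y
    simp only [RingHom.mapMatrix_apply, Matrix.map_apply, orderMatrix]
    split_ifs <;> simp
  have h3 : (RingHom.mapMatrix Knot.evalOne) (1 - Matrix.of fun x y : {x // x ∈ w.tail} =>
      if x.1.isOver then 0 else (T (x.1.sign : ℤ) - 1) * underCoeff ℤ[T;T⁻¹] w x y) = 1 := by
    rw [map_sub, map_one, sub_eq_self]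
    ext x y
    simp only [RingHom.mapMatrix_apply, Matrix.map_apply, Matrix.of_apply]
    split_ifs <;> simp [Knot.evalOne, eval₂_T]
  rw [map_mul, h1, h3] at h
  have h4 := congrArg Matrix.det h
  rw [Matrix.det_mul, Matrix.det_one, mul_comm] at h4
  rw [h2, ← RingHom.map_det]
  exact (IsUnit.of_mul_eq_one _ h4).map C

/-- If `x` comes first, the first factor is `-1` exactly when `y` precedes `x.flip`, the second is
`1` exactly when `y.flip` precedes `x`, and both are `0` otherwise. -/
theorem underCoeff_mul_underCoeff {w : List Passage} (hw : IsGaussCode w) {x y : Passage}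
    (hx : x ∈ w) (hy : y ∈ w) (hxo : x.isOver = false) (hyo : y.isOver = false) (h : x ≠ y) :
    underCoeff ℚ w x y * underCoeff ℚ w y x =
      -((if OUUO w x y then 1 else 0) + if OUUO w y x then 1 else 0) := by
  have h1 : x ≠ y.flip := fun e => by simp [e, hyo] at hxo
  have h2 : y ≠ x.flip := fun e => by simp [e, hxo] at hyo
  have n1 := not_before_iff hw.nodup hx hy h
  have n2 := not_before_iff hw.nodup hx (hw.flip_mem _ hy) h1
  have n3 := not_before_iff hw.nodup hy (hw.flip_mem _ hx) h2
  simp only [underCoeff, OUUO, hxo, hyo, true_and, h1, h2, false_or, ← n1, ← n2, ← n3]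
  by_cases b1 : before w x y <;> by_cases b2 : before w x y.flip <;>
    by_cases b3 : before w y x.flip <;> simp [b1, b2, b3]

theorem underCoeff_self {w : List Passage} (hw : w.Nodup) {x : Passage} :
    underCoeff ℚ w x x = -if before w x x.flip then 1 else 0 := by
  have := (Passage.flip_ne x).symm
  simp [underCoeff, not_before_self hw, this]

theorem not_OUUO_self {w : List Passage} (hw : w.Nodup) (x : Passage) : ¬ OUUO w x x :=
  fun h => not_before_self hw x h.2.2.2.1

/-- Both underpassages of a counted pair come after an overpassage, so deleting the first passage
loses no pair. -/
theorem sum_OUUO_tail (w : List Passage) (hw : w.Nodup) :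
    ∑ x : {x // x ∈ w.tail}, ∑ y : {x // x ∈ w.tail},
      (if OUUO w x y then ((x.1.sign : ℤ) : ℚ) * (y.1.sign : ℤ) else 0) = casson w := by
  cases w with
  | nil => exact Finset.sum_eq_zero fun x => (List.not_mem_nil x.2).elim
  | cons p l =>
  rw [List.nodup_cons] at hw
  have key : ∀ f : Passage → ℚ, f p = 0 →
      ∑ x : {x // x ∈ (p :: l).tail}, f x = ∑ x ∈ (p :: l).toFinset, f x := by
    intro f hf
    rw [List.toFinset_cons, Finset.sum_insert (by simp [hw.1]), hf, zero_add]
    exact (Finset.sum_subtype l.toFinset (by simp) f).symm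
  have hp : ∀ z, ¬ before (p :: l) z p := fun z h => by
    rw [before_cons] at h
    rcases h with h | h
    · exact hw.1 h.2
    · exact hw.1 h.right_mem
  unfold casson
  push_cast
  rw [← key]
  · refine Finset.sum_congr rfl fun x _ => ?_
    rw [← key]
    rw [if_neg (fun h => hp _ h.2.2.2.1)]
  · refine Finset.sum_eq_zero fun y _ => ?_
    rw [if_neg (fun h => hp _ h.2.2.1)]

theorem coeff_expHom_alexander {w : List Passage} (hw : IsGaussCode w) :
    let f : ℤ[T;T⁻¹] := (1 - Matrix.of fun x y : {x // x ∈ w.tail} =>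
        if x.1.isOver then 0 else (T (x.1.sign : ℤ) - 1) * underCoeff ℤ[T;T⁻¹] w x y).det
    PowerSeries.coeff 0 (expHom f) = 1 ∧
      PowerSeries.coeff 2 (expHom f) - PowerSeries.coeff 1 (expHom f) ^ 2 / 2 = casson w := by
  intro f
  set M : Matrix {x // x ∈ w.tail} {x // x ∈ w.tail} (PowerSeries ℚ) := Matrix.of fun x y =>
    if x.1.isOver then 0 else expSubOneDivX x.1.sign * PowerSeries.C (underCoeff ℚ w x y) with hM
  have hf : expHom f = (1 - (PowerSeries.X : PowerSeries ℚ) • M).det := by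
    rw [RingHom.map_det, map_sub, map_one]
    congr 2
    ext1 x y
    simp only [RingHom.mapMatrix_apply, Matrix.map_apply, Matrix.of_apply, Matrix.smul_apply, hM,
      smul_eq_mul, mul_ite, mul_zero, ← mul_assoc, X_mul_expSubOneDivX]
    split_ifs
    · simp
    · rw [map_mul]
      congr 1
      simp only [underCoeff]
      split_ifs <;> simp
  rw [hf]
  refine ⟨(Matrix.coeff_det_one_sub_X_smul M).1, ?_⟩
  rw [(Matrix.coeff_det_one_sub_X_smul M).2, ← sum_OUUO_tail w hw.nodup]
  have hs : ∀ s : ℤˣ, (((s : ℤ) : ℚ)) ^ 2 = 1 := fun s => by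
    rcases Int.units_eq_one_or s with rfl | rfl <;> simp
  have e1 : PowerSeries.coeff 1 M.trace = ∑ x : {x // x ∈ w.tail},
      if x.1.isOver then 0 else 1 / 2 * underCoeff ℚ w x x := by
    rw [Matrix.trace, map_sum]
    refine Finset.sum_congr rfl fun x _ => ?_
    simp only [hM, Matrix.diag_apply, Matrix.of_apply]
    split_ifs
    · simp
    · rw [PowerSeries.coeff_mul_C, coeff_one_expSubOneDivX, hs]
  have e2 : PowerSeries.coeff 0 (M * M).trace = ∑ x : {x // x ∈ w.tail}, ∑ y : {x // x ∈ w.tail},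
      ((if x = y then if x.1.isOver then 0 else -underCoeff ℚ w x x else 0) -
        (if OUUO w x y then ((x.1.sign : ℤ) : ℚ) * (y.1.sign : ℤ) else 0) -
        (if OUUO w y x then ((y.1.sign : ℤ) : ℚ) * (x.1.sign : ℤ) else 0)) := by
    rw [Matrix.trace, map_sum]
    refine Finset.sum_congr rfl fun x _ => ?_
    rw [Matrix.diag_apply, Matrix.mul_apply, map_sum]
    refine Finset.sum_congr rfl fun y _ => ?_
    have hx := List.mem_of_mem_tail x.2
    have hy := List.mem_of_mem_tail y.2
    simp only [hM, Matrix.of_apply]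
    by_cases hxo : x.1.isOver
    · simp [hxo, OUUO]
    by_cases hyo : y.1.isOver
    · have : x ≠ y := by rintro rfl; exact hxo hyo
      simp [hyo, OUUO, this]
    simp only [hxo, hyo, if_false, Bool.false_eq_true]
    have e : PowerSeries.coeff 0 (expSubOneDivX x.1.sign * PowerSeries.C (underCoeff ℚ w x y) *
        (expSubOneDivX y.1.sign * PowerSeries.C (underCoeff ℚ w y x))) =
        ((x.1.sign : ℤ) : ℚ) * (y.1.sign : ℤ) * (underCoeff ℚ w x y * underCoeff ℚ w y x) := by
      rw [PowerSeries.coeff_zero_eq_constantCoeff_apply, map_mul, ← PowerSeries.coeff_zero_eq_constantCoeff_apply,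
        ← PowerSeries.coeff_zero_eq_constantCoeff_apply, PowerSeries.coeff_mul_C, PowerSeries.coeff_mul_C,
        coeff_zero_expSubOneDivX, coeff_zero_expSubOneDivX]
      ring
    rw [e]
    by_cases h : x = y
    · subst h
      have := hs x.1.sign
      rw [← sq, this, underCoeff_self hw.nodup, if_pos rfl, if_neg (not_OUUO_self hw.nodup _)]
      split_ifs <;> norm_num
    · rw [underCoeff_mul_underCoeff hw hx hy (by simpa using hxo) (by simpa using hyo)
        (fun e => h (Subtype.ext e)), if_neg h]
      split_ifs <;> ring
  rw [e1, e2]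
  simp only [Finset.sum_sub_distrib]
  rw [Finset.sum_comm (f := fun x y : {x // x ∈ w.tail} =>
    if OUUO w y x then ((y.1.sign : ℤ) : ℚ) * (x.1.sign : ℤ) else 0)]
  simp only [Finset.sum_ite_eq, Finset.mem_univ, if_true]
  -- The linear terms of `(exp (s X) - 1) / X` cancel the diagonal of `M * M`: `s ^ 2 = 1`, and the
  -- diagonal coefficients are `0` or `-1`, so their squares are their negatives.
  have e3 : ∑ x : {x // x ∈ w.tail}, (if x.1.isOver then 0 else -underCoeff ℚ w x x) =
      -2 * ∑ x : {x // x ∈ w.tail}, if x.1.isOver then 0 else 1 / 2 * underCoeff ℚ w x x := by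
    rw [Finset.mul_sum]
    refine Finset.sum_congr rfl fun x _ => ?_
    split_ifs <;> ring
  rw [e3]
  ring

end GaussCode

namespace Knot

theorem evalOne_deriv_deriv_eq_casson {w : List Passage} (hw : IsGaussCode w) {Δ : ℤ[T;T⁻¹]}
    (h : Associated Δ (GaussCode.alexanderMinor w)) (hs : LaurentPolynomial.invert Δ = Δ)
    (h1 : evalOne Δ = 1) :
    (evalOne (deriv (deriv Δ)) : ℚ) / 2 = GaussCode.casson w := by
  obtain ⟨c0, c2⟩ := GaussCode.coeff_expHom_alexander hw
  rw [← c2]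
  refine evalOne_deriv_deriv_of_associated (h.trans ?_) hs h1 ?_
  · rw [← GaussCode.alexander_mul_orderMatrix hw, Matrix.det_mul]
    exact (associated_mul_unit_right _ _ (GaussCode.isUnit_det_orderMatrix hw))
  · rw [coeff_zero_expHom] at c0
    exact_mod_cast c0

end Knot

/-! ### Sums and functions along the closed curve -/

namespace GaussCode

theorem next_mem {w : List Passage} {x : Passage} (hx : x ∈ w) : next w x ∈ w :=
  (List.formPerm_mem_iff_mem).2 hx

theorem sum_next (w : List Passage) (f : Passage → ℚ) :
    ∑ x ∈ w.toFinset, f (next w x) = ∑ x ∈ w.toFinset, f x :=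
  Finset.sum_equiv (next w) (by simp [next, List.formPerm_mem_iff_mem]) (by simp)

theorem sum_flip {α : Type*} [AddCommMonoid α] {w : List Passage} (hw : IsGaussCode w)
    (f : Passage → α) : ∑ x ∈ w.toFinset, f x.flip = ∑ x ∈ w.toFinset, f x := by
  refine Finset.sum_bij' (fun x _ => x.flip) (fun x _ => x.flip) ?_ ?_ ?_ ?_ ?_ <;>
    simp +contextual [hw.flip_mem]

theorem eq_of_next_eq {α : Type*} {w : List Passage} (hw : w.Nodup) {f : Passage → α}
    (hf : ∀ x ∈ w, f (next w x) = f x) {x y : Passage} (hx : x ∈ w) (hy : y ∈ w) : f x = f y := by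
  have key : ∀ (l a : List Passage) (z : Passage), w = a ++ z :: l → ∀ x ∈ l, f x = f z := by
    intro l
    induction l with
    | nil => simp
    | cons b l ih =>
      intro a z h x hx
      have hz : f b = f z := by
        rw [← hf z (by simp [h])]
        subst h
        rw [next_append_cons_cons hw]
      rcases List.mem_cons.1 hx with rfl | hx
      · exact hz
      · rw [ih (a ++ [z]) b (by simp [h]) x hx, hz]
  cases w with
  | nil => simp at hx
  | cons p l =>
    have key' : ∀ x ∈ p :: l, f x = f p := fun x hx => by
      rcases List.mem_cons.1 hx with rfl | hx
      · rfl
      · exact key l [] p rfl x hx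
    rw [key' x hx, key' y hy]

theorem sum_map_next_sub {w : List Passage} (hw : w.Nodup) (g : Passage → ℚ) (z : Passage)
    (t : List Passage) (l s : List Passage) (a : Passage) (h : w = s ++ a :: l ++ z :: t) :
    ((a :: l).map fun x => g (next w x) - g x).sum = g z - g a := by
  induction l generalizing s a with
  | nil =>
    subst h
    simp only [List.append_assoc, List.cons_append, List.nil_append] at hw ⊢
    simp [next_append_cons_cons hw]
  | cons b l ih =>
    rw [List.map_cons, List.sum_cons, ih (s ++ [a]) b (by simp [h])]
    have : next w a = b := by
      subst h
      simp only [List.append_assoc, List.cons_append] at hw ⊢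
      exact next_append_cons_cons hw
    rw [this]
    ring

/-! ### Functions on the faces -/

theorem otherEnd_otherEnd (w : List Passage) (d : Passage × Bool) :
    otherEnd w (otherEnd w d) = d := by
  rcases d with ⟨x, _ | _⟩ <;> simp [otherEnd]

theorem rotate_rotate (x : Passage) (b : Bool) : rotate (rotate (x, b)) = (x, !b) := by
  rcases x with ⟨c, o, s⟩
  rcases Int.units_eq_one_or s with rfl | rfl <;> cases o <;> cases b <;> simp [rotate, Passage.flip]

theorem rotate_eq (x : Passage) (b : Bool) :
    rotate (x, b) = (x.flip, if x.isOver = decide (x.sign = 1) then b else !b) := rfl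

/-- A function on the half-edges that is constant along the boundary of each face. -/
def FaceConstant (w : List Passage) (φ : Passage × Bool → ℚ) : Prop :=
  ∀ x ∈ w, ∀ b, φ (faceStep w (x, b)) = φ (x, b)

/-- The difference of the values of a function on the two sides of an edge. -/
def edgeDiff (w : List Passage) (φ : Passage × Bool → ℚ) (x : Passage) : ℚ :=
  φ (x, true) - φ (next w x, false)

/-- `otherEnd` is an involution, so a face step from the other end of the edge is a bare rotation.
-/
theorem FaceConstant.rotate_eq_otherEnd {w : List Passage} {φ : Passage × Bool → ℚ}
    (h : FaceConstant w φ) {x : Passage} (hx : x ∈ w) (b : Bool) :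
    φ (rotate (x, b)) = φ (otherEnd w (x, b)) := by
  have key : φ (faceStep w (otherEnd w (x, b))) = φ (otherEnd w (x, b)) := by
    cases b
    · exact h _ (next_symm_mem hx) _
    · exact h _ (next_mem hx) _
  rwa [faceStep, otherEnd_otherEnd] at key

theorem FaceConstant.edgeDiff_eq {w : List Passage} {φ : Passage × Bool → ℚ}
    (h : FaceConstant w φ) {x : Passage} (hx : x ∈ w) :
    edgeDiff w φ x = φ (x, true) - φ (rotate (x, true)) := by
  rw [h.rotate_eq_otherEnd hx, edgeDiff, otherEnd]

theorem FaceConstant.edgeDiff_next_symm {w : List Passage} {φ : Passage × Bool → ℚ}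
    (h : FaceConstant w φ) {x : Passage} (hx : x ∈ w) :
    edgeDiff w φ ((next w).symm x) = φ (rotate (x, false)) - φ (x, false) := by
  rw [h.rotate_eq_otherEnd hx, edgeDiff, otherEnd, Equiv.apply_symm_apply]

/-- Face boundaries are orthogonal to gradients of functions on the crossings. After summation by
parts, the contributions of the two passages through each crossing cancel. -/
theorem FaceConstant.sum_mul_edgeDiff {w : List Passage} (hw : IsGaussCode w)
    {φ : Passage × Bool → ℚ} (h : FaceConstant w φ) {g : Passage → ℚ}
    (hg : ∀ x ∈ w, g x.flip = g x) :
    ∑ x ∈ w.toFinset, (g (next w x) - g x) * edgeDiff w φ x = 0 := by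
  have h1 : ∑ x ∈ w.toFinset, g (next w x) * edgeDiff w φ x =
      ∑ x ∈ w.toFinset, g x * edgeDiff w φ ((next w).symm x) := by
    rw [← sum_next w fun x => g x * edgeDiff w φ ((next w).symm x)]
    simp
  have h2 : ∀ x ∈ w.toFinset, g x * edgeDiff w φ ((next w).symm x) - g x * edgeDiff w φ x =
      g x.flip * (φ (x.flip, true) + φ (x.flip, false)) -
        g x * (φ (x, true) + φ (x, false)) := by
    intro x hx
    have hx := List.mem_toFinset.1 hx
    rw [h.edgeDiff_next_symm hx, h.edgeDiff_eq hx, hg x hx, rotate_eq, rotate_eq]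
    split_ifs <;> (try simp only [Bool.not_true, Bool.not_false]) <;> ring
  simp only [sub_mul, Finset.sum_sub_distrib]
  rw [h1, ← Finset.sum_sub_distrib, Finset.sum_congr rfl h2, Finset.sum_sub_distrib,
    sum_flip hw (fun x => g x * (φ (x, true) + φ (x, false))), sub_self]

/-- With no jump across any edge, `φ` is constant around each crossing, and the single curve
connects all crossings. -/
theorem FaceConstant.const_of_edgeDiff_eq_zero {w : List Passage} (hw : w.Nodup)
    {φ : Passage × Bool → ℚ} (h : FaceConstant w φ) (hφ : ∀ x ∈ w, edgeDiff w φ x = 0)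
    (hflip : ∀ x ∈ w, x.flip ∈ w) {x y : Passage} (hx : x ∈ w) (hy : y ∈ w) (b c : Bool) :
    φ (x, b) = φ (y, c) := by
  have hrot : ∀ x ∈ w, ∀ b, φ (rotate (x, b)) = φ (x, b) := by
    intro x hx b
    cases b
    · have := h.edgeDiff_next_symm hx
      rw [hφ _ (next_symm_mem hx)] at this
      linarith
    · have := h.edgeDiff_eq hx
      rw [hφ _ hx] at this
      linarith
  have hb : ∀ x ∈ w, ∀ b, φ (x, b) = φ (x, true) := by
    intro x hx b
    cases b
    · rw [← hrot x hx true, ← Bool.not_true, ← rotate_rotate]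
      exact hrot _ (hflip x hx) _
    · rfl
  rw [hb x hx, hb y hy]
  refine eq_of_next_eq (f := fun x => φ (x, true)) hw (fun x hx => ?_) hx hy
  have := hφ x hx
  rw [edgeDiff, hb _ (next_mem hx)] at this
  linarith

/-! ### Discrete Hodge decomposition on the sphere -/

/-- The set of faces. -/
abbrev Face (w : List Passage) : Type :=
  Quot fun d e : {x // x ∈ w} × Bool => faceStep w (d.1.1, d.2) = (e.1.1, e.2)

/-- The overpassages of a Gauss code. -/
abbrev OverPassage (w : List Passage) : Type := {x // x ∈ w.toFinset.filter fun x => x.isOver = true}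

theorem card_overPassage {w : List Passage} (hw : IsGaussCode w) :
    2 * Fintype.card (OverPassage w) = w.length := by
  have h1 : Fintype.card (OverPassage w) = (w.toFinset.filter fun x => x.isOver = true).card :=
    Fintype.card_coe _
  have h2 : (w.toFinset.filter fun x => x.isOver = true).card =
      (w.toFinset.filter fun x => ¬ x.isOver = true).card := by
    refine Finset.card_bij' (fun x _ => x.flip) (fun x _ => x.flip) ?_ ?_ ?_ ?_ <;>
      simp +contextual [hw.flip_mem]
  rw [h1, ← List.toFinset_card_of_nodup hw.nodup,
    ← Finset.card_filter_add_card_filter_not (s := w.toFinset) (fun x => x.isOver = true)]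
  omega

open Classical in
/-- The function on half-edges given by a function on the faces. -/
noncomputable def halfEdgeFun (w : List Passage) : (Face w → ℚ) →ₗ[ℚ] (Passage × Bool → ℚ) where
  toFun φ d := if h : d.1 ∈ w then φ (Quot.mk _ (⟨d.1, h⟩, d.2)) else 0
  map_add' φ ψ := by ext d; by_cases h : d.1 ∈ w <;> simp [h]
  map_smul' c φ := by ext d; by_cases h : d.1 ∈ w <;> simp [h]

theorem faceStep_mem {w : List Passage} (hw : ∀ x ∈ w, x.flip ∈ w) {x : Passage} (hx : x ∈ w)
    (b : Bool) : (faceStep w (x, b)).1 ∈ w := by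
  cases b
  · exact hw _ (next_symm_mem hx)
  · exact hw _ (next_mem hx)

theorem faceConstant_halfEdgeFun {w : List Passage} (hw : ∀ x ∈ w, x.flip ∈ w) (φ : Face w → ℚ) :
    FaceConstant w (halfEdgeFun w φ) := by
  intro x hx b
  have h := faceStep_mem hw hx b
  simp only [halfEdgeFun, LinearMap.coe_mk, AddHom.coe_mk, h, hx, dif_pos]
  refine congrArg φ (Eq.symm ?_)
  apply Quot.sound
  rfl

open Classical in
/-- The function on passages given by a function on the crossings. -/
noncomputable def crossingFun (w : List Passage) : (OverPassage w → ℚ) →ₗ[ℚ] (Passage → ℚ) where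
  toFun g x := if h : (if x.isOver then x else x.flip) ∈
    w.toFinset.filter (fun x => x.isOver = true) then g ⟨_, h⟩ else 0
  map_add' φ ψ := by
    ext x
    by_cases h : (if x.isOver then x else x.flip) ∈ w.toFinset.filter (fun x => x.isOver = true)
    · simp only [h, dif_pos, Pi.add_apply]
    · simp only [h, dif_neg, Pi.add_apply, not_false_eq_true, add_zero]
  map_smul' c φ := by
    ext x
    by_cases h : (if x.isOver then x else x.flip) ∈ w.toFinset.filter (fun x => x.isOver = true)
    · simp only [h, dif_pos, Pi.smul_apply, RingHom.id_apply]
    · simp only [h, dif_neg, Pi.smul_apply, RingHom.id_apply, not_false_eq_true, smul_zero]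

theorem crossingFun_flip (w : List Passage) (g : OverPassage w → ℚ) (x : Passage) :
    crossingFun w g x.flip = crossingFun w g x := by
  have : (if x.flip.isOver then x.flip else x.flip.flip) = if x.isOver then x else x.flip := by
    cases h : x.isOver <;> simp [h]
  simp only [crossingFun, LinearMap.coe_mk, AddHom.coe_mk, this]

theorem crossingFun_coe (w : List Passage) (g : OverPassage w → ℚ) (x : OverPassage w) :
    crossingFun w g x.1 = g x := by
  have h : (if x.1.isOver then x.1 else x.1.flip) = x.1 := if_pos (Finset.mem_filter.1 x.2).2
  have h' : x.1 ∈ w.toFinset.filter (fun x => x.isOver = true) := x.2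
  simp only [crossingFun, LinearMap.coe_mk, AddHom.coe_mk, h, h', dif_pos]

/-- A function on the faces and a function on the crossings give a function on the edges. -/
noncomputable def faceCrossingMap (w : List Passage) :
    ((Face w → ℚ) × (OverPassage w → ℚ)) →ₗ[ℚ] ({x // x ∈ w} → ℚ) where
  toFun f x := edgeDiff w (halfEdgeFun w f.1) x +
    (crossingFun w f.2 (next w x) - crossingFun w f.2 x)
  map_add' f g := by ext x; simp [edgeDiff]; ring
  map_smul' c f := by ext x; simp [edgeDiff]; ring

/-- The two summands are orthogonal, so if their sum vanishes, the gradient has squared norm zero.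
-/
theorem edgeDiff_and_crossingFun_eq_zero {w : List Passage} (hw : IsGaussCode w)
    {f : (Face w → ℚ) × (OverPassage w → ℚ)} (hf : faceCrossingMap w f = 0) :
    ∀ x ∈ w, edgeDiff w (halfEdgeFun w f.1) x = 0 ∧
      crossingFun w f.2 (next w x) = crossingFun w f.2 x := by
  have hx : ∀ x ∈ w, edgeDiff w (halfEdgeFun w f.1) x =
      -(crossingFun w f.2 (next w x) - crossingFun w f.2 x) := fun x hx =>
    eq_neg_of_add_eq_zero_left (congrFun hf ⟨x, hx⟩)
  have h := (faceConstant_halfEdgeFun hw.flip_mem f.1).sum_mul_edgeDiff hw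
    (g := crossingFun w f.2) (fun x _ => crossingFun_flip w f.2 x)
  have h' : ∑ x ∈ w.toFinset, (crossingFun w f.2 (next w x) - crossingFun w f.2 x) ^ 2 = 0 := by
    rw [← neg_eq_zero, ← Finset.sum_neg_distrib, ← h]
    refine Finset.sum_congr rfl fun x h => ?_
    rw [hx x (List.mem_toFinset.1 h)]
    ring
  rw [Finset.sum_eq_zero_iff_of_nonneg (fun x _ => sq_nonneg _)] at h'
  intro x h
  have := pow_eq_zero_iff (two_ne_zero) |>.1 (h' x (List.mem_toFinset.2 h))
  exact ⟨by rw [hx x h, this, neg_zero], sub_eq_zero.1 this⟩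

/-- The source has dimension `F + V = E + 2` and the kernel at most `2`, so the rank is `E`. -/
theorem faceCrossingMap_surjective {w : List Passage} (hw : IsGaussCode w) (hp : IsPlanar w) :
    Function.Surjective (faceCrossingMap w) := by
  rcases hp with rfl | hp
  · exact fun f => ⟨0, funext fun x => (List.not_mem_nil x.2).elim⟩
  rcases eq_or_ne w [] with rfl | hne
  · exact fun f => ⟨0, funext fun x => (List.not_mem_nil x.2).elim⟩
  obtain ⟨p, hpw⟩ := List.exists_mem_of_ne_nil w hne
  have := Fintype.ofFinite (Face w)
  -- Kernel elements are pairs of constants, hence determined by their values at one passage.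
  let ev : LinearMap.ker (faceCrossingMap w) →ₗ[ℚ] ℚ × ℚ :=
    { toFun := fun f => (halfEdgeFun w f.1.1 (p, true), crossingFun w f.1.2 p)
      map_add' := fun f g => by simp
      map_smul' := fun c f => by simp }
  have hev : Function.Injective ev := by
    rw [injective_iff_map_eq_zero]
    rintro ⟨f, hf⟩ h
    obtain ⟨h1, h2⟩ := Prod.mk.inj h
    have key := edgeDiff_and_crossingFun_eq_zero hw hf
    refine Subtype.ext (Prod.ext ?_ ?_)
    · funext d
      induction d using Quot.ind with
      | mk d =>
      obtain ⟨⟨x, hx⟩, b⟩ := d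
      have := (faceConstant_halfEdgeFun hw.flip_mem f.1).const_of_edgeDiff_eq_zero hw.nodup
        (fun x hx => (key x hx).1) hw.flip_mem hx hpw b true
      rw [h1] at this
      simp only [halfEdgeFun, LinearMap.coe_mk, AddHom.coe_mk, hx, dif_pos] at this
      exact this
    · funext x
      rw [← crossingFun_coe w f.2]
      have hx : x.1 ∈ w := List.mem_toFinset.1 (Finset.mem_filter.1 x.2).1
      rw [eq_of_next_eq hw.nodup (f := crossingFun w f.2) (fun x hx => (key x hx).2) hx hpw]
      exact h2
  have h1 := LinearMap.finrank_le_finrank_of_injective hev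
  have h2 := LinearMap.finrank_range_add_finrank_ker (faceCrossingMap w)
  have h3 : Module.finrank ℚ (Face w → ℚ) = faceCount w := by
    rw [Module.finrank_fintype_fun_eq_card, ← Nat.card_eq_fintype_card]; rfl
  have h4 := card_overPassage hw
  have h5 : Module.finrank ℚ ({x // x ∈ w} → ℚ) = w.length := by
    rw [Module.finrank_fintype_fun_eq_card, ← List.toFinset_card_of_nodup hw.nodup]
    simp [← Fintype.card_coe]
  rw [Module.finrank_prod, Module.finrank_self] at h1
  rw [Module.finrank_prod, h3, Module.finrank_fintype_fun_eq_card] at h2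
  rw [← LinearMap.range_eq_top]
  apply Submodule.eq_top_of_finrank_eq
  have := Submodule.finrank_le (LinearMap.range (faceCrossingMap w))
  omega

/-- On a sphere, every cycle is the boundary of a combination of faces. -/
theorem exists_edgeDiff_eq {w : List Passage} (hw : IsGaussCode w) (hp : IsPlanar w)
    (c : Passage → ℚ) (hc : ∀ g : Passage → ℚ, (∀ x ∈ w, g x.flip = g x) →
      ∑ x ∈ w.toFinset, (g (next w x) - g x) * c x = 0) :
    ∃ φ, FaceConstant w φ ∧ ∀ x ∈ w, edgeDiff w φ x = c x := by
  obtain ⟨f, hf⟩ := faceCrossingMap_surjective hw hp (fun x => c x)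
  have hφ := faceConstant_halfEdgeFun hw.flip_mem f.1
  refine ⟨halfEdgeFun w f.1, hφ, ?_⟩
  have hx : ∀ x ∈ w, edgeDiff w (halfEdgeFun w f.1) x +
      (crossingFun w f.2 (next w x) - crossingFun w f.2 x) = c x := fun x hx =>
    congrFun hf ⟨x, hx⟩
  have hg := fun x (_ : x ∈ w) => crossingFun_flip w f.2 x
  -- The gradient part is orthogonal to the cycle `c` and to the face part, hence to itself.
  have h' : ∑ x ∈ w.toFinset, (crossingFun w f.2 (next w x) - crossingFun w f.2 x) ^ 2 = 0 := by
    rw [← sub_zero (0 : ℚ)]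
    nth_rewrite 1 [← hc _ hg]
    rw [← hφ.sum_mul_edgeDiff hw hg, ← Finset.sum_sub_distrib]
    refine Finset.sum_congr rfl fun x h => ?_
    rw [← hx x (List.mem_toFinset.1 h)]
    ring
  rw [Finset.sum_eq_zero_iff_of_nonneg (fun x _ => sq_nonneg _)] at h'
  intro x h
  have := pow_eq_zero_iff (two_ne_zero) |>.1 (h' x (List.mem_toFinset.2 h))
  rw [← hx x h, this, add_zero]

end GaussCode

/-! ### Intersection numbers of the two loops at a crossing -/

namespace GaussCode

/-- The sign of the intersection of the branch of the passage `x` with the other branch. -/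
def intersectionSign (x : Passage) : ℤ := if x.isOver then x.sign else -x.sign

/-- Two quarter turns lead from `(x, true)` to `(x, false)`. The first costs nothing by `h0`; the
second crosses the outgoing or the incoming half of the other branch, depending on the sign, and
`he` gives both halves the same coefficient. -/
theorem FaceConstant.sub_eq {w : List Passage} {φ : Passage × Bool → ℚ}
    (h : FaceConstant w φ) {x : Passage} (hx : x ∈ w) (hx' : x.flip ∈ w)
    (he : edgeDiff w φ ((next w).symm x.flip) = edgeDiff w φ x.flip) (h0 : edgeDiff w φ x = 0) :
    φ (x, true) - φ (x, false) = intersectionSign x * edgeDiff w φ x.flip := by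
  have h1 := h.edgeDiff_eq hx
  have h2 := h.edgeDiff_eq hx'
  have h3 := h.edgeDiff_next_symm hx'
  have h4 := rotate_rotate x true
  rw [rotate_eq] at h1
  rw [rotate_eq x true] at h4
  unfold intersectionSign
  have hs := Int.units_eq_one_or x.sign
  by_cases hc : x.isOver = decide (x.sign = 1)
  · rw [if_pos hc] at h1 h4
    rw [h4] at h2
    have : (if x.isOver then (x.sign : ℤ) else -x.sign) = 1 := by
      rcases hs with hs | hs <;> simp [hs] at hc <;> simp [hs, hc]
    rw [this]
    simp only [Bool.not_true] at h2
    push_cast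
    linarith
  · rw [if_neg hc] at h1 h4
    simp only [Bool.not_true] at h1 h4
    rw [h4] at h3
    have : (if x.isOver then (x.sign : ℤ) else -x.sign) = -1 := by
      rcases hs with hs | hs <;> simp [hs] at hc <;> simp [hs, hc]
    rw [this]
    push_cast
    linarith

/-- In a planar diagram the two loops at a crossing have algebraic intersection number zero. -/
theorem sum_intersectionSign_of_cons {w : List Passage} (hw : IsGaussCode w) (hp : IsPlanar w)
    {p : Passage} {u v : List Passage} (h : w = p :: u ++ p.flip :: v) :
    (v.map fun y => if y.flip ∈ u then intersectionSign y else 0).sum = 0 := by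
  have hnd := hw.nodup
  set q := p.flip with hq
  have hpu : p ∉ u := fun hx => by simp [h, hx] at hnd
  have hqu : q ∉ u := fun hx => by simp [h, List.nodup_append] at hnd; grind
  have hqv : q ∉ v := fun hx => by simp [h, List.nodup_append, hx] at hnd
  have hpq : p ≠ q := fun hx => by simp [h, ← hx] at hnd
  have hpv : p ∉ v := fun hx => by simp [h, hx] at hnd
  have huv : ∀ x ∈ u, x ∉ v := fun x hx hx' => by
    rw [h, List.nodup_append] at hnd
    exact hnd.2.2 x (by simp [hx]) x (by simp [hx']) rfl
  -- The loop from `p` to `q` as a chain of edges, each named by the passage it follows. It is a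
  -- cycle because a gradient telescopes along it and `p`, `q` are the same crossing; the resulting
  -- `φ` acts as its winding number.
  let c : Passage → ℚ := fun x => if x ∈ p :: u then 1 else 0
  have hc : ∀ g : Passage → ℚ, (∀ x ∈ w, g x.flip = g x) →
      ∑ x ∈ w.toFinset, (g (next w x) - g x) * c x = 0 := by
    intro g hg
    have e := sum_map_next_sub hnd g q v u [] p h
    rw [hg p (by simp [h]), sub_self, ← List.sum_toFinset _
      (by simp [h, List.nodup_append] at hnd; simp; tauto)] at e
    rw [← e]
    symm
    rw [Finset.sum_congr rfl (g := fun x => (g (next w x) - g x) * c x)]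
    · refine Finset.sum_subset (fun x hx => ?_) fun x _ hx => ?_
      · rw [List.mem_toFinset] at *
        rw [h]
        exact List.mem_append_left _ hx
      · rw [List.mem_toFinset] at hx
        simp only [c, if_neg hx, mul_zero]
    · intro x hx
      rw [List.mem_toFinset] at hx
      simp only [c, if_pos hx, mul_one]
  obtain ⟨φ, hφ, hd⟩ := exists_edgeDiff_eq hw hp c hc
  have hpw : p ∈ w := by simp [h]
  have hqw : q ∈ w := by simp [h]
  have hbefore : ∀ x ∈ w, before w x q ↔ x ∈ p :: u := by
    intro x hx
    have n1 : ∀ {l}, q ∉ l → ¬ before l x q := fun h h' => h h'.right_mem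
    have := n1 hqv
    have := n1 hqu
    have : p :: u ++ q :: v = p :: (u ++ q :: v) := rfl
    rw [h, this, before_cons, before_append, before_cons]
    simp only [List.mem_cons, List.mem_append]
    tauto
  have hcb : ∀ x ∈ w, c x = if before w x q then 1 else 0 := fun x hx => by
    simp only [c, hbefore x hx]
  have hl : ∀ x ∈ w, x ≠ p → x ∈ u ++ q :: v := fun x hx hxp => by
    rw [h] at hx
    simpa [hxp] using hx
  have hbn : ∀ x ∈ w, x ≠ p → ∀ y, before w y x ↔
      y = (next w).symm x ∨ before w y ((next w).symm x) := fun x hx hxp y => by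
    have h' : w = p :: (u ++ q :: v) := h
    have := before_next_symm (p := p) (h' ▸ hnd) (hl x hx hxp) y
    rwa [← h'] at this
  have hprev : ∀ x ∈ w, x ≠ p → x ≠ q → c ((next w).symm x) = c x := by
    intro x hx hxp hxq
    have hb := hbn x hx hxp q
    have hs := next_symm_mem hx
    rw [hcb _ hs, hcb _ hx]
    congr 1
    rw [← not_before_iff hnd hqw hx (Ne.symm hxq), eq_iff_iff]
    rw [hb]
    by_cases hqs : q = (next w).symm x
    · rw [← hqs]
      simp [not_before_self hnd]
    · rw [← not_before_iff hnd hqw hs hqs]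
      tauto
  have hcq : c ((next w).symm q) = 1 := by
    have hb := hbn q hqw hpq.symm ((next w).symm q)
    rw [hcb _ (next_symm_mem hqw), if_pos (hb.2 (Or.inl rfl))]
  have hcp0 : c p = 1 := by simp [c]
  have hcq0 : c q = 0 := by simp [c, hqu, hpq.symm]
  have hflip : p = q.flip := by simp [hq]
  have hcpp : c ((next w).symm p) = 0 := by
    -- The coefficient of `c` changes only at `p` and `q`, and the total change around the circle is
    -- zero.
    have e : ∑ x ∈ w.toFinset, (c ((next w).symm x) - c x) = 0 := by
      rw [Finset.sum_sub_distrib, ← sum_next w fun x => c ((next w).symm x)]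
      simp
    rw [Finset.sum_eq_add p q hpq (fun x hx hne => by
        rw [hprev x (List.mem_toFinset.1 hx) hne.1 hne.2, sub_self])
      (fun hx => (hx (List.mem_toFinset.2 hpw)).elim)
      (fun hx => (hx (List.mem_toFinset.2 hqw)).elim), hcq, hcp0, hcq0] at e
    linarith
  have hq1 := hφ.edgeDiff_eq hqw
  have hp2 := hφ.edgeDiff_next_symm hpw
  -- The complementary loop leaves after `q` and returns at `p` through edges on which `c` vanishes,
  -- so its winding number starts and ends with the same value.
  have hend : φ (p, false) = φ (q, true) := by
    have h4 := rotate_rotate q false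
    rw [rotate_eq, ← hflip] at hq1
    rw [rotate_eq q false, ← hflip] at h4
    rw [hd q hqw, hcq0] at hq1
    rw [hd _ (next_symm_mem hpw), hcpp] at hp2
    by_cases hcond : q.isOver = decide (q.sign = 1)
    · rw [if_pos hcond] at h4
      rw [h4] at hp2
      simp only [Bool.not_false] at hp2
      linarith
    · rw [if_neg hcond] at hq1
      simp only [Bool.not_true] at hq1
      linarith
  -- Along the complementary loop, the winding number jumps only where the first loop is crossed.
  have hv : ∀ y ∈ v, φ (next w y, false) - φ (y, false) =
      if y.flip ∈ u then (intersectionSign y : ℚ) else 0 := by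
    intro y hy
    have hyw : y ∈ w := by simp [h, hy]
    have hyfw := hw.flip_mem y hyw
    have hyp : y.flip ≠ p := by
      rintro rfl
      rw [hq, Passage.flip_flip] at hqv
      exact hqv hy
    have hyq : y.flip ≠ q := by
      intro e
      rw [hq] at e
      exact hpv (Passage.flip_injective e ▸ hy)
    have h0 : edgeDiff w φ y = 0 := by
      rw [hd y hyw]
      have h1 : y ≠ p := by rintro rfl; exact hpv hy
      have h2 : y ∉ u := fun hx => huv y hx hy
      simp [c, h1, h2]
    have := hφ.sub_eq hyw hyfw
      (by rw [hd _ (next_symm_mem hyfw), hd _ hyfw, hprev _ hyfw hyp hyq]) h0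
    rw [hd _ hyfw] at this
    rw [edgeDiff] at h0
    rw [show φ (next w y, false) = φ (y, true) by linarith, this]
    simp [c, hyp]
  have hnq : φ (next w q, false) = φ (q, true) := by
    have := hd q hqw
    rw [edgeDiff, hcq0] at this
    linarith
  have htot : (w.map fun x => φ (next w x, false) - φ (x, false)).sum = 0 := by
    rw [← List.sum_toFinset _ hnd, Finset.sum_sub_distrib, sum_next w fun x => φ (x, false),
      sub_self]
  have hpart := sum_map_next_sub hnd (fun x => φ (x, false)) q v u [] p h
  have hsplit : ∀ f : Passage → ℚ,
      (w.map f).sum = ((p :: u).map f).sum + (f q + (v.map f).sum) := fun f => by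
    rw [h, List.map_append, List.sum_append]
    exact congrArg _ List.sum_cons
  have hvs : (v.map fun x => φ (next w x, false) - φ (x, false)).sum = 0 := by
    have := hsplit fun x => φ (next w x, false) - φ (x, false)
    rw [htot, hpart, hnq] at this
    linarith
  rw [List.map_congr_left hv] at hvs
  have : (((v.map fun y => if y.flip ∈ u then intersectionSign y else 0).sum : ℤ) : ℚ) = 0 := by
    rw [← hvs, Int.cast_list_sum, List.map_map]
    congr 1
    refine List.map_congr_left fun y _ => ?_
    simp only [Function.comp]
    split_ifs <;> simp
  exact_mod_cast this

end GaussCode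

/-! ### The index of a crossing -/

namespace GaussCode

theorem _root_.IsGaussCode.of_perm {w w' : List Passage} (hw : IsGaussCode w) (h : w.Perm w') :
    IsGaussCode w' where
  nodup := h.nodup_iff.1 hw.nodup
  flip_mem x hx := h.mem_iff.1 (hw.flip_mem x (h.mem_iff.2 hx))
  sign_eq x hx y hy := hw.sign_eq x (h.mem_iff.2 hx) y (h.mem_iff.2 hy)

theorem IsPlanar.of_isRotated {w w' : List Passage} (hw : w.Nodup) (hp : IsPlanar w)
    (h : w ~r w') : IsPlanar w' := by
  rcases hp with rfl | hp
  · exact Or.inl (List.isRotated_nil_iff'.1 h).symm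
  · right
    have hn : next w' = next w := (List.formPerm_eq_of_isRotated hw h).symm
    have hm : ∀ x, x ∈ w ↔ x ∈ w' := fun x => h.perm.mem_iff
    have hf : faceCount w' = faceCount w := by
      refine (Nat.card_congr (Quot.congr
        ((Equiv.subtypeEquivRight hm).prodCongr (Equiv.refl Bool)) ?_)).symm
      rintro ⟨⟨x, hx⟩, b⟩ ⟨⟨y, hy⟩, c⟩
      cases b <;> simp [faceStep, otherEnd, hn]
    rw [hf, ← h.perm.length_eq]
    exact hp

/-- The branches of the crossing of `y` are separated by the passages `x` and `x.flip`, with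
`y.flip` between `x` and `x.flip`. -/
def Linked (w : List Passage) (x y : Passage) : Prop :=
  before w x y.flip ∧ before w y.flip x.flip ∧ (before w y x ∨ before w x.flip y)

instance (w : List Passage) (x y : Passage) : Decidable (Linked w x y) :=
  inferInstanceAs (Decidable (_ ∧ _))

theorem exists_eq_append_of_before {w : List Passage} {x y : Passage} (h : before w x y) :
    ∃ t u r, w = t ++ x :: u ++ y :: r := by
  induction w with
  | nil => simp at h
  | cons a l ih =>
    rw [before_cons] at h
    rcases h with ⟨rfl, h⟩ | h
    · obtain ⟨u, r, rfl⟩ := List.append_of_mem h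
      exact ⟨[], u, r, rfl⟩
    · obtain ⟨t, u, r, rfl⟩ := ih h
      exact ⟨a :: t, u, r, rfl⟩

theorem before_left_iff {t u : List Passage} {x y : Passage} (hw : (t ++ x :: u).Nodup) :
    before (t ++ x :: u) x y ↔ y ∈ u := by
  have h1 : ¬ before t x y := fun h => by
    have := h.left_mem
    simp [List.nodup_append] at hw
    grind
  have h2 : ¬ before u x y := fun h => by
    have := h.left_mem
    simp [List.nodup_append] at hw
    grind
  have h3 : x ∉ t := fun h => by
    simp [List.nodup_append] at hw
    grind
  simp [before_append, before_cons, h1, h2, h3]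

theorem before_right_iff {t u : List Passage} {x y : Passage} (hw : (t ++ x :: u).Nodup) :
    before (t ++ x :: u) y x ↔ y ∈ t := by
  have h1 : ¬ before t y x := fun h => by
    have := h.right_mem
    simp [List.nodup_append] at hw
    grind
  have h2 : ¬ before u y x := fun h => by
    have := h.right_mem
    simp [List.nodup_append] at hw
    grind
  have h3 : x ∉ u := fun h => by
    simp [List.nodup_append] at hw
    grind
  simp [before_append, before_cons, h1, h2, h3]

theorem linked_iff {t u r : List Passage} {x y : Passage}
    (hw : (t ++ x :: u ++ x.flip :: r).Nodup) :
    Linked (t ++ x :: u ++ x.flip :: r) x y ↔ y.flip ∈ u ∧ y ∈ r ++ t := by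
  have e : t ++ x :: u ++ x.flip :: r = t ++ x :: (u ++ x.flip :: r) := by simp
  have hw' := hw
  rw [e] at hw'
  unfold Linked
  rw [before_right_iff hw, before_left_iff hw]
  rw [e, before_left_iff hw', before_right_iff hw']
  simp [List.nodup_append] at hw' ⊢
  grind

/-- The index of a crossing of a planar diagram is zero. -/
theorem sum_linked_eq_zero {w : List Passage} (hw : IsGaussCode w) (hp : IsPlanar w)
    {x : Passage} (hx : before w x x.flip) :
    ∑ y ∈ w.toFinset, (if Linked w x y then intersectionSign y else 0) = 0 := by
  obtain ⟨t, u, r, rfl⟩ := exists_eq_append_of_before hx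
  -- With `x` as base point the complementary loop becomes the contiguous word `r ++ t`.
  have hrot : (t ++ x :: u ++ x.flip :: r) ~r (x :: u ++ x.flip :: (r ++ t)) := by
    have := List.isRotated_append (l := t) (l' := x :: u ++ x.flip :: r)
    simpa using this
  have hs := sum_intersectionSign_of_cons (hw.of_perm hrot.perm) (hp.of_isRotated hw.nodup hrot) rfl
  have hnd := hw.nodup
  have hrt : (r ++ t).Nodup := by
    simp [List.nodup_append] at hnd ⊢
    grind
  refine Eq.trans ?_ hs
  rw [← List.sum_toFinset _ hrt]
  have hsub : (r ++ t).toFinset ⊆ (t ++ x :: u ++ x.flip :: r).toFinset := by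
    intro y
    simp
    tauto
  symm
  rw [← Finset.sum_subset hsub]
  · refine Finset.sum_congr rfl fun y hy => if_congr ?_ rfl rfl
    rw [linked_iff hnd, and_iff_left (List.mem_toFinset.1 hy)]
  · intro y _ hy
    rw [if_neg]
    rw [linked_iff hnd]
    exact fun h => hy (List.mem_toFinset.2 h.2)

end GaussCode

/-! ### Change of base point and renaming -/

namespace GaussCode

theorem casson_eq_sum {w : List Passage} {s : Finset Passage} (hs : w.toFinset ⊆ s) :
    casson w = ∑ x ∈ s, ∑ y ∈ s, if OUUO w x y then (x.sign : ℤ) * y.sign else 0 := by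
  unfold casson
  rw [← Finset.sum_subset hs]
  · refine Finset.sum_congr rfl fun x _ => ?_
    refine Finset.sum_subset hs fun y _ hy => if_neg fun h => hy ?_
    exact List.mem_toFinset.2 h.2.2.2.1.right_mem
  · intro x _ hx
    refine Finset.sum_eq_zero fun y _ => if_neg fun h => hx ?_
    exact List.mem_toFinset.2 h.2.2.2.1.left_mem

theorem OUUO_cons {p : Passage} {l : List Passage} (hw : (p :: l).Nodup) {x y : Passage} :
    OUUO (p :: l) x y ↔ OUUO l x y ∨ (y = p.flip ∧ (p.isOver = true ∧ x.isOver = false ∧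
      before l x p.flip ∧ before l p.flip x.flip)) := by
  have hp := (List.nodup_cons.1 hw).1
  have h1 : ∀ z, ¬ before l z p := fun z h => hp h.right_mem
  have h2 : ∀ z, ¬ before l p z := fun z h => hp h.left_mem
  have h3 : y.flip = p ↔ y = p.flip := ⟨fun h => by simp [← h], fun h => by simp [h]⟩
  simp only [OUUO, before_cons, h3]
  constructor
  · rintro ⟨hx, hy, ⟨ea, ha⟩ | ha, ⟨eb, hb⟩ | hb, ⟨ec, hc⟩ | hc⟩
    · exact absurd (eb ▸ ha) hp
    · exact absurd (eb ▸ ha) hp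
    · exact absurd (ec ▸ hb.right_mem) hp
    · right
      subst ea
      exact ⟨rfl, by simpa using hy, hx, hb, hc⟩
    · exact absurd (eb ▸ ha.right_mem) hp
    · exact absurd (eb ▸ ha.right_mem) hp
    · exact absurd (ec ▸ hb.right_mem) hp
    · exact Or.inl ⟨hx, hy, ha, hb, hc⟩
  · rintro (⟨hx, hy, ha, hb, hc⟩ | ⟨rfl, ho, hx, hb, hc⟩)
    · tauto
    · simp [ho, hx, hb, hc, hb.left_mem]

theorem OUUO_append_singleton {p : Passage} {l : List Passage} (hw : (p :: l).Nodup)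
    {x y : Passage} :
    OUUO (l ++ [p]) x y ↔ OUUO l x y ∨ (x = p.flip ∧ (p.isOver = true ∧ y.isOver = false ∧
      before l y.flip p.flip ∧ before l p.flip y)) := by
  have hp := (List.nodup_cons.1 hw).1
  have h1 : ∀ z, ¬ before l z p := fun z h => hp h.right_mem
  have h2 : ∀ z, ¬ before l p z := fun z h => hp h.left_mem
  have h3 : x.flip = p ↔ x = p.flip := ⟨fun h => by simp [← h], fun h => by simp [h]⟩
  have h4 : ∀ a b, before (l ++ [p]) a b ↔ before l a b ∨ (a ∈ l ∧ b = p) := fun a b => by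
    simp [before_append, before_cons]
  simp only [OUUO, h4, h3]
  constructor
  · rintro ⟨hx, hy, ha | ⟨ha, ea⟩, hb | ⟨hb, eb⟩, hc | ⟨hc, ec⟩⟩
    · exact Or.inl ⟨hx, hy, ha, hb, hc⟩
    · right
      subst ec
      exact ⟨rfl, by simpa using hx, hy, ha, hb⟩
    · exact absurd (eb ▸ hc.left_mem) hp
    · exact absurd (eb ▸ hc) hp
    · exact absurd (ea ▸ hb.left_mem) hp
    · exact absurd (ea ▸ hb.left_mem) hp
    · exact absurd (ea ▸ hb) hp
    · exact absurd (ea ▸ hb) hp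
  · rintro (⟨hx, hy, ha, hb, hc⟩ | ⟨rfl, ho, hx, hb, hc⟩)
    · tauto
    · simp [ho, hx, hb, hc, hc.right_mem]

/-- Only an overpassage can be the first or last point of a counted pair. For such `p`, the pairs
lost and the pairs gained are the two halves of the index sum of its crossing, which vanishes. -/
theorem casson_cons {p : Passage} {l : List Passage} (hw : IsGaussCode (p :: l))
    (hp : IsPlanar (p :: l)) : casson (p :: l) = casson (l ++ [p]) := by
  have hnd := hw.nodup
  have hpl := (List.nodup_cons.1 hnd).1
  have hs : (l ++ [p]).toFinset ⊆ (p :: l).toFinset := by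
    intro x
    simp
  have hpm : p.flip ∈ (p :: l).toFinset := List.mem_toFinset.2 (hw.flip_mem p (by simp))
  have hn1 : ∀ x, ¬ (OUUO l x p.flip) := fun x h => by
    have := h.2.2.1.left_mem
    rw [Passage.flip_flip] at this
    exact hpl this
  have hn2 : ∀ x, ¬ (OUUO l p.flip x) := fun x h => by
    have := h.2.2.2.2.right_mem
    rw [Passage.flip_flip] at this
    exact hpl this
  have e1 : ∀ x y, (if OUUO (p :: l) x y then (x.sign : ℤ) * y.sign else 0) =
      (if OUUO l x y then (x.sign : ℤ) * y.sign else 0) + if y = p.flip then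
        (if p.isOver = true ∧ x.isOver = false ∧ before l x p.flip ∧ before l p.flip x.flip then
          (x.sign : ℤ) * p.sign else 0) else 0 := fun x y => by
    simp only [OUUO_cons hnd]
    by_cases hy : y = p.flip
    · subst hy
      simp [hn1]
    · simp [hy]
  have e2 : ∀ x y, (if OUUO (l ++ [p]) x y then (x.sign : ℤ) * y.sign else 0) =
      (if OUUO l x y then (x.sign : ℤ) * y.sign else 0) + if x = p.flip then
        (if p.isOver = true ∧ y.isOver = false ∧ before l y.flip p.flip ∧ before l p.flip y then
          (y.sign : ℤ) * p.sign else 0) else 0 := fun x y => by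
    simp only [OUUO_append_singleton hnd]
    by_cases hx : x = p.flip
    · subst hx
      simp [hn2, mul_comm]
    · simp [hx]
  rw [casson_eq_sum (Finset.Subset.refl _), casson_eq_sum hs]
  simp only [e1, e2, Finset.sum_add_distrib]
  congr 1
  rw [Finset.sum_comm (s := (p :: l).toFinset) (t := (p :: l).toFinset) (f := fun x y =>
    if x = p.flip then
        (if p.isOver = true ∧ y.isOver = false ∧ before l y.flip p.flip ∧ before l p.flip y then
          (y.sign : ℤ) * p.sign else 0) else 0)]
  simp only [Finset.sum_ite_eq', hpm, if_true]
  by_cases ho : p.isOver = true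
  swap
  · simp [ho]
  have hb : before (p :: l) p p.flip := by
    rw [before_cons]
    left
    refine ⟨rfl, ?_⟩
    have := List.mem_toFinset.1 hpm
    simpa [Passage.flip_ne] using this
  have h := sum_linked_eq_zero hw hp hb
  have e3 : ∀ y ∈ (p :: l).toFinset, (if Linked (p :: l) p y then intersectionSign y else 0) =
      (if y.isOver = true ∧ before l y.flip p.flip ∧ before l p.flip y then (y.sign : ℤ) else 0) -
      (if y.isOver = false ∧ before l y.flip p.flip ∧ before l p.flip y then (y.sign : ℤ) else 0) := by
    intro y hy
    have n1 : ∀ z, ¬ before l z p := fun z h => hpl h.right_mem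
    have n2 : ∀ z, ¬ before l p z := fun z h => hpl h.left_mem
    have : Linked (p :: l) p y ↔ before l y.flip p.flip ∧ before l p.flip y := by
      simp only [Linked, before_cons, n1, n2, hpl, and_false, or_false, true_and, false_or,
        Passage.flip_ne, false_and]
      constructor
      · rintro ⟨h1, ⟨h2, h2'⟩ | h2, h3⟩
        · rw [h2] at h1; exact absurd h1 hpl
        · exact ⟨h2, h3⟩
      · rintro ⟨h1, h2⟩
        exact ⟨h1.left_mem, Or.inr h1, h2⟩
    simp only [this, intersectionSign]
    cases hyo : y.isOver <;> by_cases h1 : before l y.flip p.flip ∧ before l p.flip y <;>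
      simp [h1]
  rw [Finset.sum_congr rfl e3, Finset.sum_sub_distrib, sub_eq_zero,
    ← sum_flip hw (fun y => if y.isOver = true ∧ before l y.flip p.flip ∧ before l p.flip y then
      (y.sign : ℤ) else 0)] at h
  simp only [Passage.isOver_flip, Passage.flip_flip, Passage.sign_flip, Bool.not_eq_true'] at h
  have h' := congrArg (· * (p.sign : ℤ)) h
  simp only [Finset.sum_mul, ite_mul, zero_mul] at h'
  simpa only [ho, true_and] using h'

theorem casson_append_comm {u v : List Passage} (hw : IsGaussCode (u ++ v))
    (hp : IsPlanar (u ++ v)) : casson (u ++ v) = casson (v ++ u) := by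
  induction u generalizing v with
  | nil => simp
  | cons a u ih =>
    have hrot : a :: (u ++ v) ~r (u ++ v) ++ [a] := List.isRotated_append (l := [a])
    change casson (a :: (u ++ v)) = _
    rw [casson_cons (l := u ++ v) hw hp, List.append_assoc]
    have h1 := hw.of_perm hrot.perm
    have h2 := hp.of_isRotated hw.nodup hrot
    rw [List.append_assoc] at h1 h2
    rw [ih h1 h2]
    simp

theorem casson_map (f : Equiv.Perm ℕ) (w : List Passage) :
    casson (w.map fun x => ⟨f x.crossing, x.isOver, x.sign⟩) = casson w := by
  set F : Passage → Passage := fun x => ⟨f x.crossing, x.isOver, x.sign⟩ with hF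
  have hinj : Function.Injective F := by
    rintro ⟨a, o, s⟩ ⟨b, o', s'⟩ h
    simpa [hF] using h
  have hb : ∀ x y, before (w.map F) (F x) (F y) ↔ before w x y := by
    intro x y
    induction w with
    | nil => simp
    | cons a w ih => simp [before_cons, ih, hinj.eq_iff]
  have ho : ∀ x y, OUUO (w.map F) (F x) (F y) ↔ OUUO w x y := fun x y => by
    have hf : ∀ x, (F x).flip = F x.flip := fun x => rfl
    simp only [OUUO, hf, hb]
    rfl
  unfold casson
  have : (w.map F).toFinset = w.toFinset.image F := by
    ext; simp
  rw [this, Finset.sum_image hinj.injOn]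
  refine Finset.sum_congr rfl fun x _ => ?_
  rw [Finset.sum_image hinj.injOn]
  simp only [ho]
  rfl

end GaussCode

/-! ### The Reidemeister moves -/

namespace GaussCode

theorem casson_one (a : ℕ) (o : Bool) (s : ℤˣ) (u : List Passage)
    (hw : IsGaussCode ([⟨a, o, s⟩, ⟨a, !o, s⟩] ++ u)) :
    casson ([⟨a, o, s⟩, ⟨a, !o, s⟩] ++ u) = casson u := by
  have hnd := hw.nodup
  simp only [List.cons_append, List.nil_append] at hnd ⊢
  set p : Passage := ⟨a, o, s⟩ with hp
  have hq : (⟨a, !o, s⟩ : Passage) = p.flip := rfl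
  rw [hq] at hnd ⊢
  have hs : u.toFinset ⊆ (p :: p.flip :: u).toFinset := by
    intro x
    simp +contextual
  rw [casson_eq_sum (Finset.Subset.refl _), casson_eq_sum hs]
  refine Finset.sum_congr rfl fun x _ => Finset.sum_congr rfl fun y _ => if_congr ?_ rfl rfl
  have h1 := (List.nodup_cons.1 hnd).2
  have h2 := (List.nodup_cons.1 h1).1
  have h3 := (List.nodup_cons.1 hnd).1
  have h4 : p ∉ u := fun h => h3 (List.mem_cons_of_mem _ h)
  have n1 : ¬ before (p.flip :: u) x p.flip := by
    rw [before_cons]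
    rintro (h | h)
    · exact h2 h.2
    · exact h2 h.right_mem
  rw [OUUO_cons hnd, OUUO_cons h1]
  constructor
  · rintro ((h | ⟨rfl, -, -, h, -⟩) | ⟨-, -, -, h, -⟩)
    · exact h
    · rw [Passage.flip_flip] at h
      exact absurd h.right_mem h4
    · exact absurd h n1
  · exact fun h => Or.inl (Or.inl h)

/-- The two new crossings form counted pairs with the same old crossings and have opposite signs.
They never pair with each other, since both meet their overpassages first. -/
theorem casson_two {w u v : List Passage} {a b : ℕ} {s : ℤˣ} {m : List Passage}
    (hm : m = [⟨a, false, s⟩, ⟨b, false, -s⟩] ∨ m = [⟨b, false, -s⟩, ⟨a, false, s⟩])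
    (h : w = [⟨a, true, s⟩, ⟨b, true, -s⟩] ++ u ++ m ++ v)
    (hw : IsGaussCode w) : casson w = casson (u ++ v) := by
  have hnd := hw.nodup
  set p : Passage := ⟨a, true, s⟩ with hp
  set q : Passage := ⟨b, true, -s⟩ with hq
  have hp' : (⟨a, false, s⟩ : Passage) = p.flip := rfl
  have hq' : (⟨b, false, -s⟩ : Passage) = q.flip := rfl
  rw [hp', hq'] at hm
  have hs : (u ++ v).toFinset ⊆ w.toFinset := by
    intro x
    rw [h]
    simp
    tauto
  have hmm : ∀ x, x ∈ m ↔ x = p.flip ∨ x = q.flip := by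
    rcases hm with rfl | rfl <;> simp [or_comm]
  have hmb : ∀ x y, before m x y → (x = p.flip ∨ x = q.flip) ∧ (y = p.flip ∨ y = q.flip) :=
    fun x y h => ⟨(hmm x).1 h.left_mem, (hmm y).1 h.right_mem⟩
  have hdis : (p ∉ u ∧ p ∉ v) ∧ (q ∉ u ∧ q ∉ v) ∧ (p.flip ∉ u ∧ p.flip ∉ v) ∧
      (q.flip ∉ u ∧ q.flip ∉ v) ∧ p ≠ q ∧ (∀ x ∈ u, x ∉ v) := by
    rw [h] at hnd
    simp only [List.nodup_append, List.mem_append, hmm] at hnd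
    simp at hnd
    grind
  obtain ⟨⟨pu, pv⟩, ⟨qu, qv⟩, ⟨pu', pv'⟩, ⟨qu', qv'⟩, hpq, huv⟩ := hdis
  have hpo : p.isOver = true := rfl
  have hqo : q.isOver = true := rfl
  have hbw : ∀ x y, before w x y ↔ (x = p ∧ (y = q ∨ y ∈ u ∨ y ∈ m ∨ y ∈ v)) ∨
      (x = q ∧ (y ∈ u ∨ y ∈ m ∨ y ∈ v)) ∨ (x ∈ u ∧ y ∈ m) ∨ (x ∈ m ∧ y ∈ v) ∨ before m x y ∨
      before (u ++ v) x y := by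
    intro x y
    rw [h]
    simp only [List.cons_append, List.nil_append, before_cons, before_append, List.mem_cons,
      List.mem_append]
    grind
  have hub : ∀ x y, before (u ++ v) x y → (x ∈ u ∨ x ∈ v) ∧ (y ∈ u ∨ y ∈ v) := fun x y h =>
    ⟨List.mem_append.1 h.left_mem, List.mem_append.1 h.right_mem⟩
  have hfl : ∀ x y : Passage, x.flip = y → x = y.flip := fun x y h => by simp [← h]
  have key : ∀ x y, OUUO w x y ↔ OUUO (u ++ v) x y ∨ ((y = p.flip ∨ y = q.flip) ∧
      (x.isOver = false ∧ x ∈ u ∧ x.flip ∈ v)) := by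
    have hgen : ∀ x y, (x ≠ p ∧ x ≠ q ∧ x ≠ p.flip ∧ x ≠ q.flip) →
        (y ≠ p ∧ y ≠ q ∧ y ≠ p.flip ∧ y ≠ q.flip) → (before w x y ↔ before (u ++ v) x y) := by
      rintro x y ⟨h1, h2, h3, h4⟩ ⟨-, h6, h7, h8⟩
      have : ¬ before m x y := fun h => by simpa [h3, h4] using (hmb _ _ h).1
      simp [hbw, hmm, h1, h2, h3, h4, h6, h7, h8, this]
    have huv1 : ∀ x, x ∈ u ∨ x ∈ v → x ≠ p ∧ x ≠ q ∧ x ≠ p.flip ∧ x ≠ q.flip := by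
      intro x hx
      refine ⟨?_, ?_, ?_, ?_⟩ <;> rintro rfl <;> tauto
    have hw1 : w = [] ++ p :: (q :: (u ++ m ++ v)) := by rw [h]; simp
    have hw2 : w = [p] ++ q :: (u ++ m ++ v) := by rw [h]; simp
    have hzp : ∀ z, ¬ before w z p := fun z hz => by
      rw [hw1] at hz hnd
      simpa using (before_right_iff hnd).1 hz
    have hzq : ∀ z, before w z q → z = p := fun z hz => by
      rw [hw2] at hz hnd
      simpa using (before_right_iff hnd).1 hz
    have hover : ∀ z, z.isOver = false → z ≠ p ∧ z ≠ q := fun z hz =>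
      ⟨by rintro rfl; simp [hpo] at hz, by rintro rfl; simp [hqo] at hz⟩
    have hflip : ∀ z, (z ≠ p ∧ z ≠ q ∧ z ≠ p.flip ∧ z ≠ q.flip) →
        (z.flip ≠ p ∧ z.flip ≠ q ∧ z.flip ≠ p.flip ∧ z.flip ≠ q.flip) := by
      rintro z ⟨h1, h2, h3, h4⟩
      exact ⟨fun h => h3 (hfl _ _ h), fun h => h4 (hfl _ _ h),
        fun h => h1 (Passage.flip_injective h), fun h => h2 (Passage.flip_injective h)⟩
    have hmid : ∀ z, (z = p.flip ∨ z = q.flip) → ∀ x,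
        (x ≠ p ∧ x ≠ q ∧ x ≠ p.flip ∧ x ≠ q.flip) →
        (before w x z ↔ x ∈ u) ∧ (before w z x ↔ x ∈ v) := by
      rintro z hz x ⟨h1, h2, h3, h4⟩
      have hzm := (hmm z).2 hz
      have hxm : x ∉ m := by simp [hmm, h3, h4]
      have n1 : ¬ before m x z := fun h => hxm h.left_mem
      have n2 : ¬ before m z x := fun h => hxm h.right_mem
      have n3 : z ∉ u ∧ z ∉ v := by
        rcases hz with rfl | rfl
        exacts [⟨pu', pv'⟩, ⟨qu', qv'⟩]
      have n4 : ¬ before (u ++ v) x z := fun h => by have := (hub _ _ h).2; tauto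
      have n5 : ¬ before (u ++ v) z x := fun h => by have := (hub _ _ h).1; tauto
      have n6 : z ≠ p ∧ z ≠ q := hover z (by rcases hz with rfl | rfl <;> rfl)
      simp [hbw, h1, h2, hzm, hxm, n1, n2, n3, n4, n5, n6]
    intro x y
    constructor
    · rintro ⟨hx, hy, ha, hb, hc⟩
      have hxg : x ≠ p ∧ x ≠ q ∧ x ≠ p.flip ∧ x ≠ q.flip := by
        refine ⟨(hover x hx).1, (hover x hx).2, ?_, ?_⟩
        · rintro rfl
          rw [Passage.flip_flip] at hc
          exact hzp _ hc
        · rintro rfl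
          rw [Passage.flip_flip] at hc
          exact (hover y hy).1 (hzq _ hc)
      by_cases hyg : y = p.flip ∨ y = q.flip
      · exact Or.inr ⟨hyg, hx, (hmid y hyg x hxg).1.1 hb, (hmid y hyg _ (hflip x hxg)).2.1 hc⟩
      · have hyg : y ≠ p ∧ y ≠ q ∧ y ≠ p.flip ∧ y ≠ q.flip :=
          ⟨(hover y hy).1, (hover y hy).2, fun h => hyg (Or.inl h), fun h => hyg (Or.inr h)⟩
        exact Or.inl ⟨hx, hy, (hgen _ _ (hflip y hyg) hxg).1 ha, (hgen _ _ hxg hyg).1 hb,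
          (hgen _ _ hyg (hflip x hxg)).1 hc⟩
    · rintro (⟨hx, hy, ha, hb, hc⟩ | ⟨hyg, hx, hxu, hxv⟩)
      · have h1 := hub _ _ ha
        have h2 := hub _ _ hb
        have h3 := hub _ _ hc
        exact ⟨hx, hy, (hgen _ _ (huv1 _ h1.1) (huv1 _ h1.2)).2 ha,
          (hgen _ _ (huv1 _ h2.1) (huv1 _ h2.2)).2 hb, (hgen _ _ (huv1 _ h3.1) (huv1 _ h3.2)).2 hc⟩
      · have hxg := huv1 x (Or.inl hxu)
        refine ⟨hx, by rcases hyg with rfl | rfl <;> rfl, ?_, (hmid y hyg x hxg).1.2 hxu,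
          (hmid y hyg _ (hflip x hxg)).2.2 hxv⟩
        rw [hbw]
        rcases hyg with rfl | rfl <;> simp [hxu]
  have hpm : p.flip ∈ w.toFinset := by rw [h]; simp [hmm]
  have hqm : q.flip ∈ w.toFinset := by rw [h]; simp [hmm]
  have hne : p.flip ≠ q.flip := fun e => hpq (Passage.flip_injective e)
  have e : ∀ x y, (if OUUO w x y then (x.sign : ℤ) * y.sign else 0) =
      (if OUUO (u ++ v) x y then (x.sign : ℤ) * y.sign else 0) +
      ((if y = p.flip then if x.isOver = false ∧ x ∈ u ∧ x.flip ∈ v then (x.sign : ℤ) * s else 0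
        else 0) -
      (if y = q.flip then if x.isOver = false ∧ x ∈ u ∧ x.flip ∈ v then (x.sign : ℤ) * s else 0
        else 0)) := by
    intro x y
    simp only [key]
    have hn : ∀ z, (z = p.flip ∨ z = q.flip) → ¬ OUUO (u ++ v) x z := by
      intro z hz h
      have := hub _ _ h.2.2.2.1
      rcases hz with rfl | rfl <;> tauto
    have hsq : ((-s : ℤˣ) : ℤ) = -(s : ℤ) := by simp
    have hsp : p.flip.sign = s := rfl
    have hsq' : q.flip.sign = -s := rfl
    by_cases hy : y = p.flip
    · subst hy
      simp only [hn _ (Or.inl rfl), hsp, hne, true_or, true_and, false_or, if_true, if_false]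
      ring
    · by_cases hy' : y = q.flip
      · subst hy'
        simp only [hn _ (Or.inr rfl), hsq', hsq, hne.symm, or_true, true_and, false_or,
          if_true, if_false]
        split_ifs <;> ring
      · simp only [hy, hy', or_false, false_and, if_false]
        ring
  rw [casson_eq_sum (Finset.Subset.refl _), casson_eq_sum hs]
  simp only [e, Finset.sum_add_distrib, Finset.sum_sub_distrib, Finset.sum_ite_eq', hpm, hqm,
    if_true, sub_self, add_zero]

theorem mem_ordered {s : ℤˣ} {x y z : Passage} : z ∈ ordered s x y ↔ z = x ∨ z = y := by
  unfold ordered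
  split_ifs <;> simp [or_comm]

theorem before_ordered {s : ℤˣ} {x y a b : Passage} :
    before (ordered s x y) a b ↔ (s = 1 ∧ a = x ∧ b = y) ∨ (s = -1 ∧ a = y ∧ b = x) := by
  rcases Int.units_eq_one_or s with rfl | rfl <;> simp [ordered, before_cons]

end GaussCode

namespace GaussCode

/-- Reordering inside the strands can affect only two passages on the same strand. -/
theorem before_blocks {T T' M M' B B' u v r : List Passage} (hT : ∀ x, x ∈ T ↔ x ∈ T')
    (hM : ∀ x, x ∈ M ↔ x ∈ M') (hB : ∀ x, x ∈ B ↔ x ∈ B') {a b : Passage}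
    (h : before (T ++ u ++ M ++ v ++ B ++ r) a b) :
    before (T' ++ u ++ M' ++ v ++ B' ++ r) a b ∨ before T a b ∨ before M a b ∨ before B a b := by
  simp only [before_append, List.mem_append, hT, hM, hB] at h ⊢
  grind

/-- In a counted pair, one crossing is met under first. Here all three triangle crossings are met
over first, so no counted pair lies inside the triangle and the order within a strand is irrelevant.
-/
theorem OUUO_TMB {p q c : Passage} {u v r : List Passage} {α β γ α' β' γ' : ℤˣ}
    (hp : p.isOver = true) (hq : q.isOver = true) (hc : c.isOver = true)
    (hw : (ordered α p q ++ u ++ ordered γ p.flip c ++ v ++ ordered β q.flip c.flip ++ r).Nodup)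
    {x y : Passage}
    (h : OUUO (ordered α p q ++ u ++ ordered γ p.flip c ++ v ++ ordered β q.flip c.flip ++ r) x y) :
    OUUO (ordered α' p q ++ u ++ ordered γ' p.flip c ++ v ++ ordered β' q.flip c.flip ++ r)
      x y := by
  have hb := @before_blocks (ordered α p q) (ordered α' p q) (ordered γ p.flip c)
    (ordered γ' p.flip c) (ordered β q.flip c.flip) (ordered β' q.flip c.flip) u v r
    (by simp [mem_ordered]) (by simp [mem_ordered]) (by simp [mem_ordered])
  have n1 := before.not_before hw (x := p) (y := c.flip) (by simp [before_append, mem_ordered])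
  have n2 := before.not_before hw (x := q) (y := c.flip) (by simp [before_append, mem_ordered])
  have n3 := before.not_before hw (x := c) (y := q.flip) (by simp [before_append, mem_ordered])
  have n4 := before.not_before hw (x := p.flip) (y := c.flip)
    (by simp [before_append, mem_ordered])
  have hf : ∀ {x y : Passage}, x.flip = y → x = y.flip := fun {x y} h => by simp [← h]
  obtain ⟨hx, hy, h1, h2, h3⟩ := h
  have k1 := hb h1
  have k2 := hb h2
  have k3 := hb h3
  simp only [before_ordered] at k1 k2 k3
  refine ⟨hx, hy, ?_, ?_, ?_⟩
  · grind [Passage.isOver_flip, Passage.flip_flip]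
  · grind [Passage.isOver_flip, Passage.flip_flip]
  · grind [Passage.isOver_flip, Passage.flip_flip]

/-- Now only the crossing of `c` is met under first, so the two excluded pairs are the only
candidates inside the triangle. -/
theorem OUUO_TBM {p q c : Passage} {u v r : List Passage} {α β γ α' β' γ' : ℤˣ}
    (hp : p.isOver = true) (hq : q.isOver = true) (hc : c.isOver = true)
    (hw : (ordered α p q ++ u ++ ordered β q.flip c.flip ++ v ++ ordered γ p.flip c ++ r).Nodup)
    {x y : Passage} (hxy : ¬ (x = c.flip ∧ y = p.flip)) (hxy' : ¬ (x = c.flip ∧ y = q.flip))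
    (h : OUUO (ordered α p q ++ u ++ ordered β q.flip c.flip ++ v ++ ordered γ p.flip c ++ r) x y) :
    OUUO (ordered α' p q ++ u ++ ordered β' q.flip c.flip ++ v ++ ordered γ' p.flip c ++ r)
      x y := by
  have hb := @before_blocks (ordered α p q) (ordered α' p q) (ordered β q.flip c.flip)
    (ordered β' q.flip c.flip) (ordered γ p.flip c) (ordered γ' p.flip c) u v r
    (by simp [mem_ordered]) (by simp [mem_ordered]) (by simp [mem_ordered])
  have n1 := before.not_before hw (x := p) (y := c.flip) (by simp [before_append, mem_ordered])
  have n2 := before.not_before hw (x := q) (y := c.flip) (by simp [before_append, mem_ordered])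
  have hf : ∀ {x y : Passage}, x.flip = y → x = y.flip := fun {x y} h => by simp [← h]
  obtain ⟨hx, hy, h1, h2, h3⟩ := h
  have k1 := hb h1
  have k2 := hb h2
  have k3 := hb h3
  simp only [before_ordered] at k1 k2 k3
  refine ⟨hx, hy, ?_, ?_, ?_⟩
  · grind [Passage.isOver_flip, Passage.flip_flip]
  · grind [Passage.isOver_flip, Passage.flip_flip]
  · grind [Passage.isOver_flip, Passage.flip_flip]

theorem casson_threeTMB (a b c : ℕ) (x y z q : ℤˣ) (u v w : List Passage)
    (h : IsGaussCode (strandT a b x y q ++ u ++ strandM a c x z q ++ v ++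
      strandB b c x y z q ++ w))
    (h' : IsGaussCode (strandT a b x y (-q) ++ u ++ strandM a c x z (-q) ++ v ++
      strandB b c x y z (-q) ++ w)) :
    casson (strandT a b x y q ++ u ++ strandM a c x z q ++ v ++ strandB b c x y z q ++ w) =
      casson (strandT a b x y (-q) ++ u ++ strandM a c x z (-q) ++ v ++
        strandB b c x y z (-q) ++ w) := by
  have hs : (strandT a b x y (-q) ++ u ++ strandM a c x z (-q) ++ v ++
      strandB b c x y z (-q) ++ w).toFinset ⊆ (strandT a b x y q ++ u ++ strandM a c x z q ++ v ++
      strandB b c x y z q ++ w).toFinset := by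
    intro x
    simp [strandT, strandM, strandB, mem_ordered]
  rw [casson_eq_sum (Finset.Subset.refl _), casson_eq_sum hs]
  refine Finset.sum_congr rfl fun x' _ => Finset.sum_congr rfl fun y' _ => if_congr ?_ rfl rfl
  exact ⟨OUUO_TMB (p := ⟨a, true, x⟩) (q := ⟨b, true, y⟩) (c := ⟨c, true, z⟩) rfl rfl rfl h.nodup,
    OUUO_TMB (p := ⟨a, true, x⟩) (q := ⟨b, true, y⟩) (c := ⟨c, true, z⟩) rfl rfl rfl h'.nodup⟩

theorem OUUO_TBM_iff {p q c : Passage} {u v r : List Passage} {α β γ : ℤˣ}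
    (hp : p.isOver = true) (hq : q.isOver = true) (hc : c.isOver = true)
    (hw : (ordered α p q ++ u ++ ordered β q.flip c.flip ++ v ++
      ordered γ p.flip c ++ r).Nodup) :
    (OUUO (ordered α p q ++ u ++ ordered β q.flip c.flip ++ v ++ ordered γ p.flip c ++ r)
      c.flip p.flip ↔ γ = 1) ∧
    (OUUO (ordered α p q ++ u ++ ordered β q.flip c.flip ++ v ++ ordered γ p.flip c ++ r)
      c.flip q.flip ↔ β = -1) := by
  constructor
  · simp only [OUUO, Passage.isOver_flip, Passage.flip_flip, hp, hc, Bool.not_true, true_and]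
    constructor
    · rintro ⟨-, -, h⟩
      by_contra hγ
      have hγ := (Int.units_eq_one_or γ).resolve_left hγ
      exact h.not_before hw (by simp [before_append, before_ordered, hγ])
    · rintro rfl
      simp [before_append, before_ordered, mem_ordered]
  · simp only [OUUO, Passage.isOver_flip, Passage.flip_flip, hq, hc, Bool.not_true, true_and]
    constructor
    · rintro ⟨-, h, -⟩
      by_contra hβ
      have hβ : β = 1 := (Int.units_eq_one_or β).resolve_right hβ
      exact h.not_before hw (by simp [before_append, before_ordered, hβ])
    · rintro rfl
      simp [before_append, before_ordered, mem_ordered]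

theorem casson_threeTBM (a b c : ℕ) (x y z q : ℤˣ) (u v w : List Passage)
    (h : IsGaussCode (strandT a b x y q ++ u ++ strandB b c x y z q ++ v ++
      strandM a c x z q ++ w))
    (h' : IsGaussCode (strandT a b x y (-q) ++ u ++ strandB b c x y z (-q) ++ v ++
      strandM a c x z (-q) ++ w)) :
    casson (strandT a b x y q ++ u ++ strandB b c x y z q ++ v ++ strandM a c x z q ++ w) =
      casson (strandT a b x y (-q) ++ u ++ strandB b c x y z (-q) ++ v ++
        strandM a c x z (-q) ++ w) := by
  have hs : (strandT a b x y (-q) ++ u ++ strandB b c x y z (-q) ++ v ++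
      strandM a c x z (-q) ++ w).toFinset ⊆ (strandT a b x y q ++ u ++ strandB b c x y z q ++ v ++
      strandM a c x z q ++ w).toFinset := by
    intro x
    simp [strandT, strandM, strandB, mem_ordered]
  have hm : ∀ p : Passage, p = ⟨a, false, x⟩ ∨ p = ⟨b, false, y⟩ ∨ p = ⟨c, false, z⟩ →
      p ∈ (strandT a b x y q ++ u ++ strandB b c x y z q ++ v ++
      strandM a c x z q ++ w).toFinset := by
    rintro _ (rfl | rfl | rfl) <;> simp [strandT, strandM, strandB, mem_ordered]
  have hab : (⟨a, false, x⟩ : Passage) ≠ ⟨b, false, y⟩ := by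
    intro e
    have := h.nodup
    simp only [List.nodup_append, List.mem_append] at this
    refine this.1.2.2 ⟨b, false, y⟩ (Or.inl (Or.inr ?_)) ⟨a, false, x⟩ ?_ e.symm <;>
      simp [strandB, strandM, mem_ordered]
  have k1 := OUUO_TBM_iff (p := ⟨a, true, x⟩) (q := ⟨b, true, y⟩) (c := ⟨c, true, z⟩) rfl rfl rfl
    h.nodup
  have k2 := OUUO_TBM_iff (p := ⟨a, true, x⟩) (q := ⟨b, true, y⟩) (c := ⟨c, true, z⟩) rfl rfl rfl
    h'.nodup
  have k3 : ∀ s t : Passage, ¬ (s = ⟨c, false, z⟩ ∧ t = ⟨a, false, x⟩) →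
      ¬ (s = ⟨c, false, z⟩ ∧ t = ⟨b, false, y⟩) → (OUUO (strandT a b x y q ++ u ++
        strandB b c x y z q ++ v ++ strandM a c x z q ++ w) s t ↔ OUUO (strandT a b x y (-q) ++ u ++
        strandB b c x y z (-q) ++ v ++ strandM a c x z (-q) ++ w) s t) := fun s t h1 h2 =>
    ⟨OUUO_TBM (p := ⟨a, true, x⟩) (q := ⟨b, true, y⟩) (c := ⟨c, true, z⟩) rfl rfl rfl h.nodup h1 h2,
      OUUO_TBM (p := ⟨a, true, x⟩) (q := ⟨b, true, y⟩) (c := ⟨c, true, z⟩) rfl rfl rfl h'.nodup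
        h1 h2⟩
  rw [casson_eq_sum (Finset.Subset.refl _), casson_eq_sum hs]
  set S := (strandT a b x y q ++ u ++ strandB b c x y z q ++ v ++ strandM a c x z q ++ w).toFinset
  set W := strandT a b x y q ++ u ++ strandB b c x y z q ++ v ++ strandM a c x z q ++ w
  set W' := strandT a b x y (-q) ++ u ++ strandB b c x y z (-q) ++ v ++
        strandM a c x z (-q) ++ w
  have k11 : OUUO W ⟨c, false, z⟩ ⟨a, false, x⟩ ↔ q * z = 1 := k1.1
  have k12 : OUUO W ⟨c, false, z⟩ ⟨b, false, y⟩ ↔ q * x * y * z = -1 := k1.2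
  have k21 : OUUO W' ⟨c, false, z⟩ ⟨a, false, x⟩ ↔ -q * z = 1 := k2.1
  have k22 : OUUO W' ⟨c, false, z⟩ ⟨b, false, y⟩ ↔ -q * x * y * z = -1 := k2.2
  have e : ∀ s t : Passage, (if OUUO W s t then (s.sign : ℤ) * t.sign else 0) -
      (if OUUO W' s t then (s.sign : ℤ) * t.sign else 0) =
      if s = ⟨c, false, z⟩ then
        (if t = ⟨a, false, x⟩ then (if q * z = 1 then (z : ℤ) * x else 0) -
          if -q * z = 1 then (z : ℤ) * x else 0 else 0) +
        (if t = ⟨b, false, y⟩ then (if q * x * y * z = -1 then (z : ℤ) * y else 0) -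
          if -q * x * y * z = -1 then (z : ℤ) * y else 0 else 0)
      else 0 := by
    intro s t
    by_cases hs : s = ⟨c, false, z⟩
    · by_cases ht : t = ⟨a, false, x⟩
      · subst hs ht
        simp only [k11, k21, hab, if_true, if_false, add_zero]
      · by_cases ht' : t = ⟨b, false, y⟩
        · subst hs ht'
          simp only [k12, k22, hab.symm, if_true, if_false, zero_add]
        · simp only [hs, ht, ht', if_true, if_false, k3 ⟨c, false, z⟩ t (by simp [ht])
            (by simp [ht']), sub_self, add_zero]
    · simp only [hs, if_false, k3 s t (by simp [hs]) (by simp [hs]), sub_self]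
  -- The two exceptional pairs change the sum by `q * x` and `-(q * x)`; the sign conventions of the
  -- strands make them cancel.
  have hsign : ∀ q x y z : ℤˣ, (((if q * z = 1 then (z : ℤ) * x else 0) -
          if -q * z = 1 then (z : ℤ) * x else 0) +
        ((if q * x * y * z = -1 then (z : ℤ) * y else 0) -
          if -q * x * y * z = -1 then (z : ℤ) * y else 0)) = 0 := by
    decide
  rw [← sub_eq_zero]
  simp only [← Finset.sum_sub_distrib, e]
  rw [Finset.sum_eq_single (⟨c, false, z⟩ : Passage)]
  · simp only [if_true, Finset.sum_add_distrib, Finset.sum_ite_eq', hm _ (Or.inl rfl),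
      hm _ (Or.inr (Or.inl rfl))]
    exact hsign q x y z
  · intro s _ hs
    simp [hs]
  · exact fun hn => absurd (hm _ (Or.inr (Or.inr rfl))) hn

theorem casson_move {w w' : List Passage} (h : Move w w') (hw : IsGaussCode w)
    (hw' : IsGaussCode w') (hp : IsPlanar w) : casson w = casson w' := by
  cases h with
  | base u v => exact casson_append_comm hw hp
  | rename f w => exact (casson_map f w).symm
  | one a o s u => exact (casson_one a o s _ hw').symm
  | twoParallel a b s u v => exact (casson_two (Or.inl rfl) rfl hw').symm
  | twoAntiparallel a b s u v => exact (casson_two (Or.inr rfl) rfl hw').symm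
  | threeTMB a b c x y z q u v w => exact casson_threeTMB a b c x y z q u v w hw hw'
  | threeTBM a b c x y z q u v w => exact casson_threeTBM a b c x y z q u v w hw hw'

end GaussCode

/-! ### The bound by counting linked pairs -/

namespace GaussCode

/-- The overpassages whose underpassage comes later. -/
def overFirst (w : List Passage) : Finset Passage :=
  (w.toFinset.filter fun x => x.isOver = true).filter fun x => before w x x.flip

/-- The overpassages whose underpassage comes earlier. -/
def overSecond (w : List Passage) : Finset Passage :=
  (w.toFinset.filter fun x => x.isOver = true).filter fun x => ¬ before w x x.flip

theorem mem_overFirst {w : List Passage} {x : Passage} :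
    x ∈ overFirst w ↔ x.isOver = true ∧ before w x x.flip := by
  simp only [overFirst, Finset.mem_filter, List.mem_toFinset]
  exact ⟨fun h => ⟨h.1.2, h.2⟩, fun h => ⟨⟨h.2.left_mem, h.1⟩, h.2⟩⟩

theorem mem_overSecond {w : List Passage} (hw : IsGaussCode w) {x : Passage} :
    x ∈ overSecond w ↔ x.isOver = true ∧ before w x.flip x := by
  simp only [overSecond, Finset.mem_filter, List.mem_toFinset]
  constructor
  · rintro ⟨⟨h1, h2⟩, h3⟩
    exact ⟨h2, (not_before_iff hw.nodup h1 (hw.flip_mem x h1) (Passage.flip_ne x).symm).1 h3⟩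
  · rintro ⟨h1, h2⟩
    exact ⟨⟨h2.right_mem, h1⟩, h2.not_before hw.nodup⟩

theorem sum_eq_overFirst_add_overSecond {w : List Passage} (hw : IsGaussCode w)
    (f : Passage → ℤ) : ∑ x ∈ w.toFinset, f x =
      ∑ x ∈ overFirst w, (f x + f x.flip) + ∑ x ∈ overSecond w, (f x + f x.flip) := by
  rw [overFirst, overSecond, Finset.sum_filter_add_sum_filter_not, Finset.sum_add_distrib,
    ← Finset.sum_filter_add_sum_filter_not w.toFinset (fun x => x.isOver = true)]
  congr 1
  refine Finset.sum_bij' (fun x _ => x.flip) (fun x _ => x.flip) ?_ ?_ ?_ ?_ ?_ <;>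
    simp +contextual [hw.flip_mem]

theorem card_overFirst_add_card_overSecond {w : List Passage} (hw : IsGaussCode w) :
    2 * ((overFirst w).card + (overSecond w).card) = w.length := by
  have h := sum_eq_overFirst_add_overSecond hw fun _ => 1
  simp only [Finset.sum_const, nsmul_eq_mul, mul_one] at h
  rw [List.toFinset_card_of_nodup hw.nodup] at h
  push_cast at h
  omega

/-- The cyclic order `d`, `y.flip`, `d.flip`, `y` becomes linear because `y.flip` precedes `y`,
which rules out the other alternative in `Linked`. -/
theorem OUUO_flip_iff {w : List Passage} (hw : IsGaussCode w) {d y : Passage} :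
    OUUO w y.flip d.flip ↔ d ∈ overFirst w ∧ y ∈ overSecond w ∧ Linked w d y := by
  rw [mem_overFirst, mem_overSecond hw]
  have ho : ∀ z : Passage, z.flip.isOver = false ↔ z.isOver = true := fun z => by simp
  simp only [OUUO, ho, Passage.flip_flip, Linked]
  constructor
  · rintro ⟨h1, h2, h3, h4, h5⟩
    exact ⟨⟨h2, h3.trans hw.nodup h4⟩, ⟨h1, h4.trans hw.nodup h5⟩, h3, h4, Or.inr h5⟩
  · rintro ⟨⟨h1, h2⟩, ⟨h3, h4⟩, h5, h6, h7 | h7⟩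
    · exact absurd (h5.trans hw.nodup h4) (h7.not_before hw.nodup)
    · exact ⟨h3, h1, h5, h6, h7⟩

theorem casson_eq_sum_linked {w : List Passage} (hw : IsGaussCode w) :
    casson w = ∑ d ∈ overFirst w, ∑ y ∈ overSecond w,
      if Linked w d y then (d.sign : ℤ) * y.sign else 0 := by
  have hF : overFirst w ⊆ w.toFinset :=
    (Finset.filter_subset _ _).trans (Finset.filter_subset _ _)
  have hS : overSecond w ⊆ w.toFinset :=
    (Finset.filter_subset _ _).trans (Finset.filter_subset _ _)
  rw [casson, Finset.sum_comm, ← sum_flip hw, ← Finset.sum_subset hF]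
  · refine Finset.sum_congr rfl fun d hd => ?_
    rw [← sum_flip hw, ← Finset.sum_subset hS]
    · refine Finset.sum_congr rfl fun y hy => ?_
      simp only [OUUO_flip_iff hw, hd, hy, true_and, Passage.sign_flip, mul_comm]
    · intro y _ hy
      simp [OUUO_flip_iff hw, hy]
  · intro d _ hd
    rw [← sum_flip hw]
    refine Finset.sum_eq_zero fun y _ => ?_
    simp [OUUO_flip_iff hw, hd]

/-- The two arrow diagram formulas, which are mirror images of each other, have the same value. -/
theorem sum_linked_eq_sum_linked_flip {w : List Passage} (hw : IsGaussCode w) (hp : IsPlanar w) :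
    ∑ d ∈ overFirst w, ∑ y ∈ overSecond w, (if Linked w d y then (d.sign : ℤ) * y.sign else 0) =
    ∑ d ∈ overFirst w, ∑ y ∈ overSecond w,
      if Linked w d y.flip then (d.sign : ℤ) * y.sign else 0 := by
  have hover : ∀ y : Passage, y.isOver = true → ∀ d : Passage,
      (if Linked w d y then intersectionSign y else 0) +
        (if Linked w d y.flip then intersectionSign y.flip else 0) =
      (if Linked w d y then (y.sign : ℤ) else 0) - (if Linked w d y.flip then (y.sign : ℤ) else 0) := by
    intro y hy d
    simp only [intersectionSign, Passage.isOver_flip, hy, Passage.sign_flip, Bool.not_true,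
      if_true, Bool.false_eq_true, if_false]
    split_ifs <;> ring
  have hF : ∀ y ∈ overFirst w, y.isOver = true := fun y hy => (mem_overFirst.1 hy).1
  have hS : ∀ y ∈ overSecond w, y.isOver = true := fun y hy => ((mem_overSecond hw).1 hy).1
  -- The vanishing index of the crossing of `d`, weighted by the sign of `d`.
  have h0 : ∀ d ∈ overFirst w,
      ∑ y ∈ overFirst w, ((if Linked w d y then (d.sign : ℤ) * y.sign else 0) -
        (if Linked w d y.flip then (d.sign : ℤ) * y.sign else 0)) +
      ∑ y ∈ overSecond w, ((if Linked w d y then (d.sign : ℤ) * y.sign else 0) -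
        (if Linked w d y.flip then (d.sign : ℤ) * y.sign else 0)) = 0 := by
    intro d hd
    have h := sum_linked_eq_zero hw hp (mem_overFirst.1 hd).2
    rw [sum_eq_overFirst_add_overSecond hw,
      Finset.sum_congr rfl (fun y hy => hover y (hF y hy) d),
      Finset.sum_congr rfl (s₁ := overSecond w) (fun y hy => hover y (hS y hy) d)] at h
    have h' := congrArg ((d.sign : ℤ) * ·) h
    simp only [mul_add, Finset.mul_sum, mul_sub, mul_ite, mul_zero] at h'
    exact h'
  have h1 := Finset.sum_eq_zero h0
  rw [Finset.sum_add_distrib] at h1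
  -- For two crossings of the same kind, exchanging their roles exchanges the two ways of
  -- interleaving, so these terms cancel in the double sum.
  have hanti : ∀ d ∈ overFirst w, ∀ y ∈ overFirst w, (Linked w d y.flip ↔ Linked w y d) := by
    intro d hd y hy
    have hd := (mem_overFirst.1 hd).2
    have hy := (mem_overFirst.1 hy).2
    simp only [Linked, Passage.flip_flip]
    constructor
    · rintro ⟨h1, h2, h3 | h3⟩
      · exact absurd (h3.trans hw.nodup h1) (hy.not_before hw.nodup)
      · exact ⟨h2, h3, Or.inl h1⟩
    · rintro ⟨h1, h2, h3 | h3⟩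
      · exact ⟨h3, h1, Or.inr h2⟩
      · exact absurd (h3.trans hw.nodup hd) (h2.not_before hw.nodup)
  have h2 : ∑ d ∈ overFirst w, ∑ y ∈ overFirst w,
      ((if Linked w d y then (d.sign : ℤ) * y.sign else 0) -
        (if Linked w d y.flip then (d.sign : ℤ) * y.sign else 0)) = 0 := by
    simp only [Finset.sum_sub_distrib]
    rw [sub_eq_zero, Finset.sum_comm]
    refine Finset.sum_congr rfl fun d hd => Finset.sum_congr rfl fun y hy => ?_
    simp only [hanti d hd y hy, mul_comm]
  rw [h2, zero_add] at h1
  simp only [Finset.sum_sub_distrib] at h1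
  exact sub_eq_zero.1 h1

/-- Both formulas give the same value and use disjoint sets of pairs, so together they have at most
one term of size `1` for each pair. -/
theorem two_mul_abs_casson_le {w : List Passage} (hw : IsGaussCode w) (hp : IsPlanar w) :
    2 * |casson w| ≤ (overFirst w).card * (overSecond w).card := by
  have h1 := casson_eq_sum_linked hw
  have h2 := h1.trans (sum_linked_eq_sum_linked_flip hw hp)
  have hs : ∀ s t : ℤˣ, |(s : ℤ) * t| = 1 := fun s t => by
    rcases Int.units_eq_one_or s with rfl | rfl <;> rcases Int.units_eq_one_or t with rfl | rfl <;>
      simp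
  have habs : ∀ P : Passage → Passage → Prop, ∀ [∀ d y, Decidable (P d y)],
      |∑ d ∈ overFirst w, ∑ y ∈ overSecond w, if P d y then (d.sign : ℤ) * y.sign else 0| ≤
      ∑ d ∈ overFirst w, ∑ y ∈ overSecond w, if P d y then 1 else 0 := by
    intro P _
    refine (Finset.abs_sum_le_sum_abs _ _).trans (Finset.sum_le_sum fun d _ => ?_)
    refine (Finset.abs_sum_le_sum_abs _ _).trans (Finset.sum_le_sum fun y _ => ?_)
    split_ifs
    · exact (hs _ _).le
    · simp
  have h3 := habs fun d y => Linked w d y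
  have h4 := habs fun d y => Linked w d y.flip
  rw [← h1] at h3
  rw [← h2] at h4
  have h5 : ∑ d ∈ overFirst w, ∑ y ∈ overSecond w, (if Linked w d y then (1 : ℤ) else 0) +
      ∑ d ∈ overFirst w, ∑ y ∈ overSecond w, (if Linked w d y.flip then (1 : ℤ) else 0) ≤
      (overFirst w).card * (overSecond w).card := by
    simp only [← Finset.sum_add_distrib]
    have : ((overFirst w).card * (overSecond w).card : ℤ) =
        ∑ d ∈ overFirst w, ∑ y ∈ overSecond w, 1 := by simp
    rw [this]
    refine Finset.sum_le_sum fun d _ => Finset.sum_le_sum fun y _ => ?_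
    have hn : ¬ (Linked w d y ∧ Linked w d y.flip) := by
      simp only [Linked, Passage.flip_flip]
      rintro ⟨⟨-, -, h | h⟩, h', h'', -⟩
      · exact h.not_before hw.nodup h'
      · exact h.not_before hw.nodup h''
    split_ifs <;> first | exact absurd ⟨‹_›, ‹_›⟩ hn | norm_num
  linarith

theorem eight_mul_abs_casson_le {w : List Passage} (hw : IsGaussCode w) (hp : IsPlanar w) :
    8 * |casson w| ≤ ((w.length / 2 : ℕ) : ℤ) ^ 2 := by
  have h1 := two_mul_abs_casson_le hw hp
  have h2 := card_overFirst_add_card_overSecond hw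
  have h3 : w.length / 2 = (overFirst w).card + (overSecond w).card := by omega
  rw [h3]
  push_cast
  nlinarith [sq_nonneg (((overFirst w).card : ℤ) - (overSecond w).card)]

end GaussCode

/-! ### The Casson invariant of a knot -/

namespace Knot

/-- The value of the arrow diagram formula on the diagrams of a knot. -/
def casson (K : Knot) : ℤ :=
  Quot.lift (fun D : KnotDiagram => GaussCode.casson D.code)
    (fun D E h => GaussCode.casson_move h D.isGaussCode E.isGaussCode D.isPlanar) K

theorem HasDiagram.casson_eq {K : Knot} {D : KnotDiagram} (h : K.HasDiagram D) :
    K.casson = GaussCode.casson D.code := by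
  subst h
  rfl

/-- The diagram behind the chosen polynomial is arbitrary; invariance of the arrow sum makes the
choice immaterial, so neither existence nor uniqueness of the polynomial is needed. -/
theorem v₂_eq (K : Knot) (h : ∃ Δ, K.IsAlexanderPolynomial Δ) : K.v₂ = K.casson := by
  obtain ⟨⟨D, hD, hΔ⟩, hs, h1⟩ := h.choose_spec
  rw [v₂, alexanderPolynomial, dif_pos h, hD.casson_eq]
  exact evalOne_deriv_deriv_eq_casson D.isGaussCode hΔ hs h1

/-- The default polynomial `1` has zero second derivative, so the bound survives in this case as
well. -/
theorem v₂_eq_zero (K : Knot) (h : ¬ ∃ Δ, K.IsAlexanderPolynomial Δ) : K.v₂ = 0 := by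
  rw [v₂, alexanderPolynomial, dif_neg h, evalOne_deriv_deriv]
  simp [PowerSeries.coeff_one]

end Knot

theorem mainTheorem2 (K : Knot) (n : ℕ)
    (hK : ∃ D : KnotDiagram, K.HasDiagram D ∧ D.crossingCount = n) :
    |K.v₂| ≤ (⌊(n : ℚ) ^ 2 / 8⌋ : ℚ) := by
  by_cases h : ∃ Δ, K.IsAlexanderPolynomial Δ
  · obtain ⟨D, hD, rfl⟩ := hK
    have hb := GaussCode.eight_mul_abs_casson_le D.isGaussCode D.isPlanar
    rw [K.v₂_eq h, hD.casson_eq]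
    have : |GaussCode.casson D.code| ≤ ⌊(D.crossingCount : ℚ) ^ 2 / 8⌋ := by
      rw [Int.le_floor, le_div_iff₀ (by norm_num), mul_comm]
      exact_mod_cast hb
    exact_mod_cast this
  · rw [K.v₂_eq_zero h, abs_zero]
    exact Int.cast_nonneg (Int.floor_nonneg.2 (by positivity))
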